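/- Let $T^2=\mathbb{C}/\Lambda$ be a complex torus, let $P\in T^2$ and $M=T^2-\{P\}$. Let $\mathbb{R}^4_1$ be $\mathbb{R}^4$ with the inner product $\langle v,w\rangle=v_1w_1+v_2w_2+v_3w_3-v_4w_4$. Let $X:M\to\mathbb{R}^4_1$ be a complete algebraic stationary surface with one regular end, at $P$, and total curvature $-\int_M K\,\mathrm{d}M=8\pi$. That is, $X$ is a conformal spacelike immersion with zero mean curvature and complete induced metric, whose Gaussian curvature $K$ satisfies $-\int_M K\,\mathrm{d}M=8\pi$, and $$X=2\,\mathrm{Re}\int\big(\phi+\psi,\,-\mathrm{i}(\phi-\psi),\,1-\phi\psi,\,1+\phi\psi\big)\,\mathrm{d}h ,$$ where the Weierstrass data $\phi,\psi:T^2\to\mathbb{C}\cup\{\infty\}$ (meromorphic functions) and $\mathrm{d}h$ (a meromorphic 1-form on $T^2$, holomorphic on $M$) satisfy: 1. $\phi\neq\overline{\psi}$ at every point of $M$, and the poles of $\phi$ and $\psi$ on $M$ do not coincide; 2. on $M$, the zeros of $\mathrm{d}h$ coincide with the poles of $\phi$ or $\psi$, with the same order; 3. along every closed path $\gamma$ in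 $M$, $\oint_\gamma\phi\,\mathrm{d}h=-\overline{\oint_\gamma\psi\,\mathrm{d}h}$ and $\mathrm{Re}\oint_\gamma\mathrm{d}h=\mathrm{Re}\oint_\gamma\phi\psi\,\mathrm{d}h=0$ (so that $X$ is well defined on $M$); 4. the end is regular: $\phi(P)\neq\overline{\psi(P)}$. Suppose the data are normalized so that $\phi(P)=0$ and $\psi(P)=\infty$. Then the divisors on $T^2$ of $\phi,\psi,\mathrm{d}h$ are of one of the following two forms. Case 1: there are points $C_1,C_2,V_1,V_2,N_1,N_2$ of $T^2-\{P\}$, not necessarily distinct, with $$(\phi)=P+C_1-V_1-V_2,\quad (\psi)=-P-C_2+N_1+N_2,\quad (\mathrm{d}h)=-3P+V_1+V_2+C_2 .$$ Case 2: there are points $C_1,C_2,V_1,V_2$ of $T^2-\{P\}$, not necessarily distinct, with $$(\phi)=2P-V_1-V_2,\quad (\psi)=-2P+C_1+C_2,\quad (\mathrm{d}h)=-2P+V_1+V_2 .$$ -/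

import Mathlib

namespace StationaryTorus

open Set Filter Topology MeasureTheory
open scoped ContDiff

/-! ### The torus and meromorphic functions on it -/

/-- The complex torus `T² = ℂ / Λ`, where `Λ` is the lattice spanned by a pair of periods. -/
abbrev Torus (L : PeriodPair) : Type := ℂ ⧸ L.lattice.toAddSubgroup

/-- The universal covering `ℂ → T²`; its variable `z` is a global coordinate on the universal
cover, and `dz` is a nowhere vanishing holomorphic 1-form on `T²`. -/
def proj (L : PeriodPair) (z : ℂ) : Torus L := QuotientAddGroup.mk z

/-- A map on the torus read in the coordinate `z`, i.e. as a `Λ`-periodic map on `ℂ`. -/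
def lift {L : PeriodPair} {β : Type*} (f : Torus L → β) : ℂ → β := fun z => f (proj L z)

/-- `f` is a meromorphic function on the torus. (As usual in Mathlib, the function values at poles
and on a discrete set carry no information; they are never used below.) -/
def IsMeromorphic {L : PeriodPair} (f : Torus L → ℂ) : Prop :=
  ∀ z : ℂ, MeromorphicAt (lift f) z

open Classical in
/-- The value in `ℂ ∪ {∞}` at `z` of a function meromorphic at `z`: it is `∞` at a pole,
and the limit at `z` otherwise. -/
noncomputable def sphereValue (f : ℂ → ℂ) (z : ℂ) : OnePoint ℂ :=
  if meromorphicOrderAt f z < 0 then OnePoint.infty else ((limUnder (𝓝[≠] z) f : ℂ) : OnePoint ℂ)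

/-- Complex conjugation on `ℂ ∪ {∞}`. -/
def sphereConj : OnePoint ℂ → OnePoint ℂ := OnePoint.map (starRingEnd ℂ)

/-- The multiplicity of the pole of `f` at `z` (zero if `z` is not a pole). -/
noncomputable def poleOrder (f : ℂ → ℂ) (z : ℂ) : ℕ := (-(meromorphicOrderAt f z).untop₀).toNat

/-- The divisor of `f` is the formal sum `D` of points of the torus. In particular, `f` does not
vanish identically. The divisor of the 1-form `h dz` is the divisor of `h`. -/
def HasDivisor {L : PeriodPair} (f : Torus L → ℂ) (D : Torus L →₀ ℤ) : Prop :=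
  ∀ z : ℂ, meromorphicOrderAt (lift f) z = ((D (proj L z) : ℤ) : WithTop ℤ)

/-! ### Spacelike surfaces in Lorentz space `ℝ⁴₁`, parametrized by the punctured torus -/

/-- The Lorentz inner product of signature `(+,+,+,-)`. -/
def lorentz (v w : Fin 4 → ℝ) : ℝ := v 0 * w 0 + v 1 * w 1 + v 2 * w 2 - v 3 * w 3

/-- The part of the universal cover that lies over `M = T² - {P}`. -/
def punctured {L : PeriodPair} (P : Torus L) : Set ℂ := {z | proj L z ≠ P}

/-- The first fundamental form of `X`, at the point with coordinate `z`. -/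
noncomputable def inducedMetric {L : PeriodPair} (X : Torus L → Fin 4 → ℝ) (z v w : ℂ) : ℝ :=
  lorentz (fderiv ℝ (lift X) z v) (fderiv ℝ (lift X) z w)

/-- The coefficient `E = ⟨X_x, X_x⟩` of the first fundamental form, where `z = x + i y`. For a
conformal immersion the induced metric is `E (dx² + dy²)`, with area element `E dx dy`. -/
noncomputable def conformalFactor {L : PeriodPair} (X : Torus L → Fin 4 → ℝ) (z : ℂ) : ℝ :=
  inducedMetric X z 1 1

/-- `X : T² - {P} → ℝ⁴₁` is a smooth conformal spacelike immersion. -/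
structure IsConformalSpacelikeImmersion {L : PeriodPair} (P : Torus L)
    (X : Torus L → Fin 4 → ℝ) : Prop where
  smooth : ContDiffOn ℝ ∞ (lift X) (punctured P)
  conformal : ∀ z ∈ punctured P, ∀ v w : ℂ,
    inducedMetric X z v w = conformalFactor X z * inner ℝ v w
  spacelike : ∀ z ∈ punctured P, 0 < conformalFactor X z

/-- The mean curvature vector `ΔX / (2E)` of a conformal immersion (in the conformal coordinate
`z`, with the flat Laplacian `Δ = ∂²/∂x² + ∂²/∂y²`). -/
noncomputable def meanCurvature {L : PeriodPair} (X : Torus L → Fin 4 → ℝ) (z : ℂ) :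
    Fin 4 → ℝ :=
  (2 * conformalFactor X z)⁻¹ • Laplacian.laplacian (lift X) z

/-- `X : T² - {P} → ℝ⁴₁` is a stationary surface, i.e. spacelike with zero mean curvature,
in a conformal parametrization. -/
structure IsStationary {L : PeriodPair} (P : Torus L) (X : Torus L → Fin 4 → ℝ) : Prop
    extends IsConformalSpacelikeImmersion P X where
  zero_mean_curvature : ∀ z ∈ punctured P, meanCurvature X z = 0

/-- The induced metric on `T² - {P}` is complete: every curve that leaves all compact subsets of
`T² - {P}`, i.e. that tends to `P` in the torus, has infinite length. (Curves in `T² - {P}`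
are written as projections of curves in the universal cover of `T²`.) -/
def IsCompleteSurface {L : PeriodPair} (P : Torus L) (X : Torus L → Fin 4 → ℝ) : Prop :=
  ∀ γ : ℝ → ℂ, ContDiffOn ℝ 1 γ (Ico 0 1) → (∀ t ∈ Ico (0 : ℝ) 1, γ t ∈ punctured P) →
    Tendsto (fun t => proj L (γ t)) (𝓝[<] 1) (𝓝 P) →
    ∫⁻ t in Ioo (0 : ℝ) 1,
      ENNReal.ofReal (Real.sqrt (inducedMetric X (γ t) (deriv γ t) (deriv γ t))) = ⊤

/-- The Gaussian curvature of the metric `E (dx² + dy²)`, namely `K = - Δ (log E) / (2E)`. -/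
noncomputable def gaussCurvature {L : PeriodPair} (X : Torus L → Fin 4 → ℝ) (z : ℂ) : ℝ :=
  -(Laplacian.laplacian (fun w => Real.log (conformalFactor X w)) z) / (2 * conformalFactor X z)

/-- The form `K dM`, as a density with respect to `dx dy`. -/
noncomputable def curvatureDensity {L : PeriodPair} (X : Torus L → Fin 4 → ℝ) (z : ℂ) : ℝ :=
  gaussCurvature X z * conformalFactor X z

/-- The total curvature `- ∫_M K dM` is finite and equal to `c`. The integral over `M = T² - {P}`
is taken over a fundamental parallelogram of the lattice. -/
def HasTotalCurvature {L : PeriodPair} (X : Torus L → Fin 4 → ℝ) (c : ℝ) : Prop :=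
  IntegrableOn (curvatureDensity X) (ZSpan.fundamentalDomain L.basis) ∧
    -(∫ z in ZSpan.fundamentalDomain L.basis, curvatureDensity X z) = c

/-! ### Weierstrass data -/

/-- The coefficients of the `ℂ⁴`-valued 1-form
`(φ + ψ, -i (φ - ψ), 1 - φ ψ, 1 + φ ψ) dh`, where `dh = h dz`. -/
noncomputable def weierstrassForm (φ ψ h : ℂ) : Fin 4 → ℂ :=
  ![(φ + ψ) * h, -Complex.I * (φ - ψ) * h, (1 - φ * ψ) * h, (1 + φ * ψ) * h]

/-- `φ, ψ, dh = h dz` are Weierstrass data of `X : M = T² - {P} → ℝ⁴₁` that are meromorphic on the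
whole torus and satisfy the regularity conditions.

The field `representation` says `X = 2 Re ∫ (φ + ψ, -i (φ - ψ), 1 - φ ψ, 1 + φ ψ) dh`, in the form
`dX = 2 Re ((φ + ψ, -i (φ - ψ), 1 - φ ψ, 1 + φ ψ) h dz)` away from the poles of `φ`, `ψ`. As `X` is
a single-valued map on `M`, it contains the period conditions
`∮ φ dh = - conj (∮ ψ dh)` and `Re ∮ dh = Re ∮ φ ψ dh = 0` along all closed paths in `M`. -/
structure IsWeierstrassData {L : PeriodPair} (P : Torus L) (X : Torus L → Fin 4 → ℝ)
    (φ ψ h : Torus L → ℂ) : Prop where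
  meromorphic_φ : IsMeromorphic φ
  meromorphic_ψ : IsMeromorphic ψ
  meromorphic_h : IsMeromorphic h
  /-- `φ ≠ conj ψ` on `M`, as maps to `ℂ ∪ {∞}`. -/
  ne_conj : ∀ z ∈ punctured P, sphereValue (lift φ) z ≠ sphereConj (sphereValue (lift ψ) z)
  /-- The poles of `φ` and `ψ` on `M` do not coincide. -/
  poles_disjoint : ∀ z ∈ punctured P, poleOrder (lift φ) z = 0 ∨ poleOrder (lift ψ) z = 0
  /-- The form `dh` is holomorphic on `M`, and its zeros are the poles of `φ` or `ψ`, with the same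
  order. (At most one summand is nonzero.) -/
  zeros_dh : ∀ z ∈ punctured P, meromorphicOrderAt (lift h) z =
    (((poleOrder (lift φ) z + poleOrder (lift ψ) z : ℕ) : ℤ) : WithTop ℤ)
  representation : ∀ z ∈ punctured P,
    AnalyticAt ℂ (lift φ) z → AnalyticAt ℂ (lift ψ) z → AnalyticAt ℂ (lift h) z →
    ∀ v : ℂ, fderiv ℝ (lift X) z v =
      fun i => 2 * (weierstrassForm (lift φ z) (lift ψ z) (lift h z) i * v).re

/-- `X : T² - {P} → ℝ⁴₁` is a complete algebraic stationary surface with Weierstrass data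
`φ, ψ, dh = h dz`, and its unique end `P` is regular, i.e. `φ ≠ conj ψ` at `P`. -/
structure IsCompleteAlgebraicStationary {L : PeriodPair} (P : Torus L) (X : Torus L → Fin 4 → ℝ)
    (φ ψ h : Torus L → ℂ) : Prop where
  stationary : IsStationary P X
  complete : IsCompleteSurface P X
  data : IsWeierstrassData P X φ ψ h
  regular_end : ∀ z : ℂ, proj L z = P →
    sphereValue (lift φ) z ≠ sphereConj (sphereValue (lift ψ) z)

/-- The formal sum `1 · p`. -/
noncomputable def pt {L : PeriodPair} (p : Torus L) : Torus L →₀ ℤ := Finsupp.single p 1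

end StationaryTorus

/-!
The proof counts poles. Let `a` be the order of the zero of `φ` and `b` the order of the pole of
`ψ` at `P`. The induced metric is `4 |φ - ψ̄|² |dh|²` (`lorentz_re_weierstrassForm`), and near `P`
it is `|z|^{2m}` times a smooth positive factor, where `m` is the order of `ψ dh` at `P`
(`exists_metric_factor`). By Gauss-Bonnet (`integral_laplacian_log`) the total curvature is
`-2π m`, so that `m = -4` (`order_add_order_eq_neg_four`). On the other hand the zeros of `dh` on
`M` are the poles of `φ` and `ψ`, and the divisor of `dh` has degree zero; hence
`deg φ + deg ψ = -m = 4`, where the degree is the number of poles (`divisor_h`). An elliptic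
function that is not constant has degree at least `2` (`two_le_degree_polarPart`), and `φ` is not
constant: if `φ = 0`, then `φ = ψ̄` at the zeros of `ψ`, which exist as `ψ` has a pole
(`order_φ_ne_top`). Therefore `deg φ = deg ψ = 2` and `a, b ∈ {1, 2}`, and `dh` has order `b - 4`
at `P`. Finally `φ dh` is holomorphic on `M`, and its order `a + b - 4` at `P` cannot be `-1` by the
residue theorem (`order_add_order_ne`), so `a = b`. The two cases are `a = b = 1` and `a = b = 2`.

All facts from analysis come from a single statement, the residue theorem for functions `F` on the
torus that are `C¹` apart from simple poles, in the form `∫ ∂F/∂z̄ = -π ∑ res F`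
(`integral_dbar_eq_sum_residues`). With `F = f'/f` it says that divisors have degree zero, with `F`
holomorphic off the poles that there is no single simple pole, and with `F = ∂ log E / ∂z`, `E` the
conformal factor, it is the Gauss-Bonnet formula. To prove it, the poles are removed by subtracting
periodic functions with a simple pole (`simplePole`), for which the integral is computed in polar
coordinates; for periodic `C¹` functions `F`, the integrals of the partial derivatives vanish because
`∫ F (z + t v)` does not depend on `t`.
-/

namespace StationaryTorus

open Set Filter Topology MeasureTheory
open scoped ContDiff Pointwise

/-! ### The Cauchy-Riemann operator -/

/-- The Cauchy-Riemann operator `∂F/∂z̄ = (∂F/∂x + i ∂F/∂y) / 2`, for real-differentiable `F`. -/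
noncomputable def dbar (F : ℂ → ℂ) (z : ℂ) : ℂ :=
  (fderiv ℝ F z 1 + Complex.I * fderiv ℝ F z Complex.I) / 2

theorem dbar_congr {F G : ℂ → ℂ} {z : ℂ} (h : F =ᶠ[𝓝 z] G) : dbar F z = dbar G z := by
  simp only [dbar, h.fderiv_eq]

theorem dbar_of_differentiableAt {F : ℂ → ℂ} {z : ℂ} (h : DifferentiableAt ℂ F z) :
    dbar F z = 0 := by
  have h1 := h.hasFDerivAt.restrictScalars ℝ
  have h2 : fderiv ℂ F z Complex.I = Complex.I * fderiv ℂ F z 1 := by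
    rw [← smul_eq_mul, ← map_smul, smul_eq_mul, mul_one]
  rw [dbar, h1.fderiv, ContinuousLinearMap.coe_restrictScalars', h2, ← mul_assoc,
    Complex.I_mul_I]
  ring

theorem dbar_sub {F G : ℂ → ℂ} {z : ℂ} (hF : DifferentiableAt ℝ F z)
    (hG : DifferentiableAt ℝ G z) : dbar (fun w => F w - G w) z = dbar F z - dbar G z := by
  simp only [dbar, fderiv_fun_sub hF hG, sub_apply]
  ring

theorem dbar_sum {ι : Type*} {T : Finset ι} {F : ι → ℂ → ℂ} {z : ℂ}
    (hF : ∀ i ∈ T, DifferentiableAt ℝ (F i) z) :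
    dbar (fun w => ∑ i ∈ T, F i w) z = ∑ i ∈ T, dbar (F i) z := by
  simp only [dbar, fderiv_fun_sum hF, sum_apply, Finset.mul_sum,
    ← Finset.sum_add_distrib, Finset.sum_div]

theorem dbar_mul {F G : ℂ → ℂ} {z : ℂ} (hF : DifferentiableAt ℝ F z)
    (hG : DifferentiableAt ℝ G z) :
    dbar (fun w => F w * G w) z = F z * dbar G z + G z * dbar F z := by
  simp only [dbar, fderiv_fun_mul hF hG, add_apply,
    smul_apply, smul_eq_mul]
  ring

theorem dbar_const_mul {G : ℂ → ℂ} {z : ℂ} (c : ℂ) (hG : DifferentiableAt ℝ G z) :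
    dbar (fun w => c * G w) z = c * dbar G z := by
  rw [dbar_mul (differentiableAt_const c) hG,
    dbar_of_differentiableAt (differentiableAt_const c), mul_zero, add_zero]

theorem dbar_comp_add_const (F : ℂ → ℂ) (a z : ℂ) :
    dbar (fun w => F (a + w)) z = dbar F (a + z) := by
  simp only [dbar, fderiv_comp_add_left]

/-! ### Integrals of periodic functions -/

instance (L : PeriodPair) : VAddInvariantMeasure L.lattice ℂ volume :=
  inferInstanceAs (VAddInvariantMeasure L.lattice.toAddSubgroup ℂ volume)

theorem isAddFundamentalDomain_lattice (L : PeriodPair) :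
    IsAddFundamentalDomain L.lattice (ZSpan.fundamentalDomain L.basis) := by
  have := ZSpan.isAddFundamentalDomain L.basis volume
  rw [← L.lattice_eq_span_range_basis] at this
  exact this

/-- `F` is invariant under translation by the lattice of periods. -/
def IsPeriodic (L : PeriodPair) {β : Type*} (F : ℂ → β) : Prop :=
  ∀ l : ℂ, l ∈ L.lattice → ∀ z, F (l + z) = F z

theorem IsPeriodic.fderiv_right {L : PeriodPair} {E : Type*} [NormedAddCommGroup E]
    [NormedSpace ℝ E] {F : ℂ → E} (hF : IsPeriodic L F) :
    IsPeriodic L (fderiv ℝ F) := fun l hl z => by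
  have : (fun w => F (l + w)) = F := funext (hF l hl)
  rw [← fderiv_comp_add_left, this]

theorem IsPeriodic.dbar_right {L : PeriodPair} {F : ℂ → ℂ} (hF : IsPeriodic L F) :
    IsPeriodic L (dbar F) := fun l hl z => by
  simp only [dbar, hF.fderiv_right l hl z]

theorem volume_fundamentalDomain_lt_top (L : PeriodPair) :
    volume (ZSpan.fundamentalDomain L.basis) < ⊤ :=
  (ZSpan.fundamentalDomain_isBounded L.basis).measure_lt_top

theorem IsPeriodic.exists_norm_le {L : PeriodPair} {E : Type*} [NormedAddCommGroup E]
    {F : ℂ → E} (hF : IsPeriodic L F) (hc : Continuous F) : ∃ B, ∀ z, ‖F z‖ ≤ B := by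
  have := IsZLattice.isCompact_range_of_periodic L.lattice F hc
    (fun z w hw => by rw [add_comm]; exact hF w hw z)
  obtain ⟨B, hB⟩ := this.isBounded.exists_norm_le
  exact ⟨B, fun z => hB _ (mem_range_self z)⟩

theorem IsPeriodic.integrableOn {L : PeriodPair} {E : Type*} [NormedAddCommGroup E]
    {F : ℂ → E} (hF : IsPeriodic L F) (hc : Continuous F) :
    IntegrableOn F (ZSpan.fundamentalDomain L.basis) := by
  obtain ⟨B, hB⟩ := hF.exists_norm_le hc
  exact IntegrableOn.of_bound (volume_fundamentalDomain_lt_top L) hc.aestronglyMeasurable B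
    (ae_of_all _ hB)

theorem IsPeriodic.setIntegral_add_left {L : PeriodPair} {F : ℂ → ℂ} (hF : IsPeriodic L F)
    (a : ℂ) : ∫ z in ZSpan.fundamentalDomain L.basis, F (a + z) =
      ∫ z in ZSpan.fundamentalDomain L.basis, F z := by
  have h1 := isAddFundamentalDomain_lattice L
  have h2 : IsAddFundamentalDomain L.lattice (a +ᵥ ZSpan.fundamentalDomain L.basis) :=
    h1.vadd_of_comm a
  have h3 := h2.setIntegral_eq h1 (f := F) (fun g x => hF g g.2 x)
  rw [← h3]
  have h4 := (measurePreserving_add_left volume a).setIntegral_preimage_emb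
    (measurableEmbedding_addLeft a) F (a +ᵥ ZSpan.fundamentalDomain L.basis)
  rw [← h4]
  congr 2
  ext z
  simp [mem_vadd_set]

/-- The integral of `F (z + t v)` over a fundamental domain does not depend on `t`. -/
theorem IsPeriodic.setIntegral_fderiv_eq_zero {L : PeriodPair} {F : ℂ → ℂ}
    (hF : IsPeriodic L F) (hc : ContDiff ℝ 1 F) (v : ℂ) :
    ∫ z in ZSpan.fundamentalDomain L.basis, fderiv ℝ F z v = 0 := by
  have hc' : Continuous (fderiv ℝ F) := hc.continuous_fderiv one_ne_zero
  obtain ⟨B, hB⟩ := hF.fderiv_right.exists_norm_le hc'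
  have key := hasDerivAt_integral_of_dominated_loc_of_deriv_le (𝕜 := ℝ)
    (μ := volume.restrict (ZSpan.fundamentalDomain L.basis))
    (F := fun t z => F (t • v + z)) (F' := fun t z => fderiv ℝ F (t • v + z) v)
    (x₀ := 0) (s := univ) (bound := fun _ => B * ‖v‖) univ_mem
    (Eventually.of_forall fun t =>
      (hc.continuous.comp (continuous_const.add continuous_id)).aestronglyMeasurable)
    (by simpa [IntegrableOn] using! hF.integrableOn hc.continuous)
    ((hc'.comp (continuous_const.add continuous_id)).clm_apply
      continuous_const).aestronglyMeasurable
    (ae_of_all _ fun z t _ => (ContinuousLinearMap.le_opNorm _ _).trans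
      (mul_le_mul_of_nonneg_right (hB _) (norm_nonneg _)))
    (by
      have := volume_fundamentalDomain_lt_top L
      exact integrableOn_const this.ne)
    (ae_of_all _ fun z t _ => by
      have h1 : HasDerivAt (fun t : ℝ => t • v + z) v t := by
        simpa using ((hasDerivAt_id t).smul_const v).add_const z
      exact ((hc.differentiable one_ne_zero _).hasFDerivAt).comp_hasDerivAt t h1)
  have h2 := key.2
  simp only [zero_smul, zero_add] at h2
  have h3 : (fun t : ℝ => ∫ z in ZSpan.fundamentalDomain L.basis, F (t • v + z)) =
      fun _ => ∫ z in ZSpan.fundamentalDomain L.basis, F z :=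
    funext fun t => hF.setIntegral_add_left _
  rw [h3] at h2
  exact h2.unique (hasDerivAt_const _ _)

/-! ### Punctured neighbourhoods and isolated singularities -/

/-- A property that holds on a punctured neighbourhood of every point holds almost everywhere. -/
theorem ae_of_forall_eventually_nhdsNE {p : ℂ → Prop} (h : ∀ z, ∀ᶠ w in 𝓝[≠] z, p w) :
    ∀ᵐ z : ℂ, p z := by
  have h1 : {z | p z} ∈ codiscrete ℂ := by
    rw [mem_codiscrete]
    intro z
    rw [disjoint_principal_right, compl_compl]
    exact h z
  have h2 := ae_restrict_le_codiscreteWithin (μ := (volume : Measure ℂ)) MeasurableSet.univ h1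
  rwa [Measure.restrict_univ] at h2

theorem tendsto_add_left_nhdsNE (l z : ℂ) :
    Tendsto (fun w => l + w) (𝓝[≠] z) (𝓝[≠] (l + z)) := by
  refine tendsto_nhdsWithin_iff.2 ⟨?_, ?_⟩
  · exact ((continuous_const.add continuous_id).tendsto z).mono_left nhdsWithin_le_nhds
  · filter_upwards [self_mem_nhdsWithin] with w hw
    simpa using hw

theorem eventually_nhdsNE_eventually_nhds {p : ℂ → Prop} {z : ℂ} (h : ∀ᶠ w in 𝓝[≠] z, p w) :
    ∀ᶠ w in 𝓝[≠] z, ∀ᶠ u in 𝓝 w, p u := by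
  have h1 := eventually_eventually_nhdsWithin.2 h
  filter_upwards [h1, self_mem_nhdsWithin] with w hw hne
  rwa [IsOpen.nhdsWithin_eq isOpen_compl_singleton hne] at hw

/-! ### Stokes' theorem on the torus -/

/-- A form of Stokes' theorem on the torus: a function that becomes `C¹` after a modification at
isolated points satisfies `∫ ∂F/∂z̄ = 0`. -/
theorem IsPeriodic.setIntegral_dbar_eq_zero {L : PeriodPair} {F : ℂ → ℂ} (hF : IsPeriodic L F)
    (h : ∀ z, ∃ g : ℂ → ℂ, ContDiffAt ℝ 1 g z ∧ F =ᶠ[𝓝[≠] z] g) :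
    IntegrableOn (dbar F) (ZSpan.fundamentalDomain L.basis) ∧
    ∫ z in ZSpan.fundamentalDomain L.basis, dbar F z = 0 := by
  choose g hg hFg using h
  set G : ℂ → ℂ := fun z => g z z with hG
  -- near `z`, the values `G w = lim F` agree with `g z w`
  have hGg : ∀ z, G =ᶠ[𝓝 z] g z := fun z => by
    have h1 : ∀ᶠ w in 𝓝 z, ContDiffAt ℝ 1 (g z) w := (hg z).eventually (by simp)
    have h2 : ∀ᶠ w in 𝓝[≠] z, G w = g z w := by
      filter_upwards [eventually_nhdsNE_eventually_nhds (hFg z),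
        h1.filter_mono nhdsWithin_le_nhds] with w hw hw1
      have h3 : g w =ᶠ[𝓝[≠] w] g z := by
        filter_upwards [hFg w, hw.filter_mono nhdsWithin_le_nhds] with u hu1 hu2
        rw [← hu1, hu2]
      exact tendsto_nhds_unique_of_eventuallyEq
        ((hg w).continuousAt.tendsto.mono_left nhdsWithin_le_nhds)
        (hw1.continuousAt.tendsto.mono_left nhdsWithin_le_nhds) h3
    exact eventually_nhdsWithin_iff.1 h2 |>.mono fun w hw => by
      by_cases hwz : w = z
      · rw [hwz]
      · exact hw hwz
  have hGc : ContDiff ℝ 1 G := contDiff_iff_contDiffAt.2 fun z =>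
    (hg z).congr_of_eventuallyEq (hGg z)
  have hFG : ∀ z, F =ᶠ[𝓝[≠] z] G := fun z =>
    (hFg z).trans ((hGg z).filter_mono nhdsWithin_le_nhds).symm
  have hGp : IsPeriodic L G := fun l hl z => by
    have h1 := tendsto_add_left_nhdsNE l z
    have h2 : (fun w => G (l + w)) =ᶠ[𝓝[≠] z] G := by
      filter_upwards [h1.eventually (hFG (l + z)), hFG z] with w hw1 hw2
      rw [← hw1, ← hw2, hF l hl]
    exact tendsto_nhds_unique_of_eventuallyEq
      ((hGc.continuous.tendsto _).comp (h1.mono_right nhdsWithin_le_nhds))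
      ((hGc.continuous.tendsto z).mono_left nhdsWithin_le_nhds) h2
  have hae : dbar F =ᵐ[volume.restrict (ZSpan.fundamentalDomain L.basis)] dbar G :=
    ae_restrict_of_ae <| ae_of_forall_eventually_nhdsNE fun z =>
      (eventually_nhdsNE_eventually_nhds (hFG z)).mono fun w hw => dbar_congr hw
  have hGd : ∀ v, Continuous fun z => fderiv ℝ G z v := fun v =>
    (hGc.continuous_fderiv one_ne_zero).clm_apply continuous_const
  have hi : ∀ v, IntegrableOn (fun z => fderiv ℝ G z v) (ZSpan.fundamentalDomain L.basis) :=
    fun v => IsPeriodic.integrableOn (fun l hl z => by simp only [hGp.fderiv_right l hl z]) (hGd v)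
  refine ⟨(integrable_congr hae).2 (((hi 1).add ((hi Complex.I).const_mul _)).div_const 2), ?_⟩
  rw [integral_congr_ae hae]
  simp only [dbar]
  rw [integral_div, integral_add (hi 1) ((hi Complex.I).const_mul _), integral_const_mul,
    hGp.setIntegral_fderiv_eq_zero hGc, hGp.setIntegral_fderiv_eq_zero hGc]
  simp

/-! ### A periodic function with a simple pole at the lattice points -/

/-- A smooth function of `t` that is `1` for `t ≤ 1` and `0` for `t ≥ 2`. -/
noncomputable def cutoff (t : ℝ) : ℝ := Real.smoothTransition (2 - t)

theorem contDiff_cutoff : ContDiff ℝ ∞ cutoff :=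
  Real.smoothTransition.contDiff.comp (contDiff_const.sub contDiff_id)

theorem cutoff_of_le_one {t : ℝ} (h : t ≤ 1) : cutoff t = 1 :=
  Real.smoothTransition.one_of_one_le (by linarith)

theorem cutoff_of_two_le {t : ℝ} (h : 2 ≤ t) : cutoff t = 0 :=
  Real.smoothTransition.zero_of_nonpos (by linarith)

theorem continuous_deriv_cutoff : Continuous (deriv cutoff) :=
  contDiff_cutoff.continuous_deriv (by simp)

theorem deriv_cutoff_of_two_lt {t : ℝ} (h : 2 < t) : deriv cutoff t = 0 := by
  have : cutoff =ᶠ[𝓝 t] fun _ => 0 := by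
    filter_upwards [lt_mem_nhds h] with s hs using cutoff_of_two_le hs.le
  rw [this.deriv_eq, deriv_const]

/-- The function `1 / z`, cut off smoothly away from the origin. -/
noncomputable def cutoffInv (z : ℂ) : ℂ := (cutoff (Complex.normSq z) : ℂ) * z⁻¹

/-- The derivative `∂/∂z̄` of `cutoffInv`, away from the origin. -/
noncomputable def cutoffInvDbar (z : ℂ) : ℂ := ((deriv cutoff (Complex.normSq z) : ℝ) : ℂ)

theorem normSq_gt_two {z : ℂ} (h : 2 ≤ ‖z‖) : 2 < Complex.normSq z := by
  rw [Complex.normSq_eq_norm_sq]; nlinarith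

theorem cutoffInv_of_two_le {z : ℂ} (h : 2 ≤ ‖z‖) : cutoffInv z = 0 := by
  rw [cutoffInv, cutoff_of_two_le (normSq_gt_two h).le]; simp

theorem cutoffInvDbar_of_two_le {z : ℂ} (h : 2 ≤ ‖z‖) : cutoffInvDbar z = 0 := by
  rw [cutoffInvDbar, deriv_cutoff_of_two_lt (normSq_gt_two h)]; simp

theorem contDiff_normSq : ContDiff ℝ ∞ Complex.normSq := by
  have : (Complex.normSq : ℂ → ℝ) = fun z => z.re * z.re + z.im * z.im :=
    funext Complex.normSq_apply
  rw [this]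
  exact (Complex.reCLM.contDiff.mul Complex.reCLM.contDiff).add
    (Complex.imCLM.contDiff.mul Complex.imCLM.contDiff)

theorem contDiff_cutoff_normSq : ContDiff ℝ ∞ fun z => (cutoff (Complex.normSq z) : ℂ) :=
  Complex.ofRealCLM.contDiff.comp (contDiff_cutoff.comp contDiff_normSq)

theorem contDiffAt_cutoffInv {z : ℂ} (hz : z ≠ 0) : ContDiffAt ℝ ∞ cutoffInv z :=
  contDiff_cutoff_normSq.contDiffAt.mul (contDiffAt_inv ℝ hz)

theorem continuous_cutoffInvDbar : Continuous cutoffInvDbar :=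
  Complex.continuous_ofReal.comp (continuous_deriv_cutoff.comp contDiff_normSq.continuous)

theorem cutoffInv_eventuallyEq : cutoffInv =ᶠ[𝓝 0] fun z => z⁻¹ := by
  have h : ∀ᶠ z : ℂ in 𝓝 0, Complex.normSq z < 1 :=
    contDiff_normSq.continuous.continuousAt.eventually_lt continuousAt_const (by simp)
  filter_upwards [h] with z hz
  rw [cutoffInv, cutoff_of_le_one hz.le]; simp

theorem hasFDerivAt_normSq (z : ℂ) :
    HasFDerivAt Complex.normSq
      ((2 * z.re) • Complex.reCLM + (2 * z.im) • Complex.imCLM : ℂ →L[ℝ] ℝ) z := by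
  have : (Complex.normSq : ℂ → ℝ) = fun z => z.re * z.re + z.im * z.im :=
    funext Complex.normSq_apply
  rw [this]
  have hr := Complex.reCLM.hasFDerivAt (x := z)
  have hi := Complex.imCLM.hasFDerivAt (x := z)
  refine ((hr.mul hr).add (hi.mul hi)).congr_fderiv ?_
  ext
  all_goals
    simp
    ring

theorem dbar_cutoff_normSq (z : ℂ) :
    dbar (fun z => (cutoff (Complex.normSq z) : ℂ)) z = (deriv cutoff (Complex.normSq z) : ℝ) * z := by
  have h1 : HasDerivAt cutoff (deriv cutoff (Complex.normSq z)) (Complex.normSq z) :=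
    (contDiff_cutoff.differentiable (by simp) _).hasDerivAt
  have h2 := Complex.ofRealCLM.hasFDerivAt.comp z (h1.comp_hasFDerivAt z (hasFDerivAt_normSq z))
  have h3 : (fun z => (cutoff (Complex.normSq z) : ℂ)) =
      Complex.ofRealCLM ∘ cutoff ∘ Complex.normSq := rfl
  rw [dbar, h3, h2.fderiv]
  simp only [ContinuousLinearMap.comp_apply, Complex.ofRealCLM_apply, smul_apply, add_apply,
    smul_eq_mul, Complex.reCLM_apply, Complex.imCLM_apply, Complex.one_re, Complex.one_im,
    Complex.I_re, Complex.I_im]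
  have h4 := Complex.re_add_im z
  push_cast
  linear_combination ((deriv cutoff (Complex.normSq z) : ℝ) : ℂ) * h4

theorem dbar_cutoffInv {z : ℂ} (hz : z ≠ 0) : dbar cutoffInv z = cutoffInvDbar z := by
  have h1 : cutoffInv = fun z => (cutoff (Complex.normSq z) : ℂ) * z⁻¹ := rfl
  have h2 : DifferentiableAt ℂ (fun z : ℂ => z⁻¹) z := differentiableAt_inv hz
  rw [h1, dbar_mul (contDiff_cutoff_normSq.differentiable (by simp) _) (h2.restrictScalars ℝ),
    dbar_of_differentiableAt h2, dbar_cutoff_normSq, cutoffInvDbar]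
  field_simp
  simp

theorem integrable_cutoffInvDbar : Integrable cutoffInvDbar := by
  refine continuous_cutoffInvDbar.integrable_of_hasCompactSupport ?_
  refine HasCompactSupport.intro (isCompact_closedBall (0 : ℂ) 2) fun z hz => ?_
  refine cutoffInvDbar_of_two_le ?_
  simp at hz
  exact hz.le

/-- In polar coordinates `∫ χ'(|z|²) = 2π ∫ χ'(r²) r dr = π (χ(∞) - χ(0)) = -π`. -/
theorem integral_cutoffInvDbar : ∫ z, cutoffInvDbar z = -Real.pi := by
  have hd : ∀ x : ℝ, HasDerivAt (fun r => cutoff (r ^ 2) / 2) (x * deriv cutoff (x ^ 2)) x := by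
    intro x
    have h1 : HasDerivAt cutoff (deriv cutoff (x ^ 2)) (x ^ 2) :=
      (contDiff_cutoff.differentiable (by simp) _).hasDerivAt
    have h2 : HasDerivAt (fun r : ℝ => r ^ 2) (2 * x) x := by simpa using hasDerivAt_pow 2 x
    exact ((HasDerivAt.comp (h := fun r : ℝ => r ^ 2) x h1 h2).div_const 2).congr_deriv (by ring)
  have h0 : ∀ r : ℝ, 2 ≤ r → cutoff (r ^ 2) / 2 = 0 := fun r hr => by
    rw [cutoff_of_two_le (by nlinarith)]; simp
  have hint : IntegrableOn (fun x : ℝ => x * deriv cutoff (x ^ 2)) (Ioi 0) := by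
    have hc : Continuous (fun x : ℝ => x * deriv cutoff (x ^ 2)) :=
      continuous_id.mul (continuous_deriv_cutoff.comp (continuous_pow 2))
    refine (hc.integrable_of_hasCompactSupport ?_).integrableOn
    refine HasCompactSupport.intro (isCompact_Icc (a := (-2 : ℝ)) (b := 2)) fun x hx => ?_
    have : 2 < x ^ 2 := by
      by_contra hcon
      exact hx ⟨by nlinarith, by nlinarith⟩
    rw [deriv_cutoff_of_two_lt this, mul_zero]
  have h1 : ∫ x in Ioi (0 : ℝ), x * deriv cutoff (x ^ 2) = -(1 / 2) := by
    rw [integral_Ioi_of_hasDerivAt_of_tendsto (m := 0) (hd 0).continuousAt.continuousWithinAt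
      (fun x _ => hd x) hint]
    · simp [cutoff_of_le_one]
    · refine tendsto_const_nhds.congr' ?_
      filter_upwards [eventually_ge_atTop 2] with r hr using (h0 r hr).symm
  have h2 := integral_fun_norm_addHaar (volume : Measure ℂ) (fun r => deriv cutoff (r ^ 2))
  simp only [Complex.finrank_real_complex] at h2
  have h3 : ∫ z : ℂ, deriv cutoff (Complex.normSq z) = -Real.pi := by
    simp only [Complex.normSq_eq_norm_sq]
    rw [h2]
    simp only [Nat.add_one_sub_one, pow_one, smul_eq_mul, h1, Measure.real, Complex.volume_ball]
    simp
    ring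
  calc ∫ z, cutoffInvDbar z = ((∫ z : ℂ, deriv cutoff (Complex.normSq z) : ℝ) : ℂ) :=
        integral_ofReal
    _ = _ := by rw [h3]; simp

/-- All but finitely many lattice translates of a bounded set avoid the disc of radius `2`, which
contains the support of `cutoffInv`. -/
theorem exists_finset_lattice (L : PeriodPair) {K : Set ℂ} (hK : Bornology.IsBounded K) :
    ∃ T : Finset L.lattice, ∀ z ∈ K, ∀ l : L.lattice, l ∉ T → 2 ≤ ‖(l : ℂ) + z‖ := by
  obtain ⟨R, hR⟩ := hK.exists_norm_le
  have hfin : (Metric.closedBall (0 : L.lattice) (R + 2)).Finite :=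
    (isCompact_closedBall _ _).finite_of_discrete
  refine ⟨hfin.toFinset, fun z hz l hl => ?_⟩
  have hl' : R + 2 < ‖(l : ℂ)‖ := by simpa using hl
  have := norm_sub_le ((l : ℂ) + z) z
  rw [add_sub_cancel_right] at this
  linarith [hR z hz]

/-- The periodization of `cutoffInv`: a periodic function, smooth off the lattice, with
singularity `1 / z` at the origin. -/
noncomputable def simplePole (L : PeriodPair) (z : ℂ) : ℂ := ∑' l : L.lattice, cutoffInv (l + z)

theorem isPeriodic_simplePole (L : PeriodPair) : IsPeriodic L (simplePole L) := fun l hl z => by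
  rw [simplePole, simplePole, ← (Equiv.addRight (⟨l, hl⟩ : L.lattice)).tsum_eq fun m => cutoffInv (m + z)]
  simp only [Equiv.coe_addRight, Submodule.coe_add, add_assoc]

theorem simplePole_eventuallyEq_sum (L : PeriodPair) (z : ℂ) :
    ∃ T : Finset L.lattice, (∀ l : L.lattice, l ∉ T → 2 ≤ ‖(l : ℂ) + z‖) ∧
      simplePole L =ᶠ[𝓝 z] fun w => ∑ l ∈ T, cutoffInv (l + w) := by
  obtain ⟨T, hT⟩ := exists_finset_lattice L (Metric.isBounded_ball (x := z) (r := 1))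
  refine ⟨T, hT z (Metric.mem_ball_self one_pos), ?_⟩
  filter_upwards [Metric.ball_mem_nhds z one_pos] with w hw
  exact tsum_eq_sum fun l hl => cutoffInv_of_two_le (hT w hw l hl)

theorem contDiffAt_cutoffInv_add {a z : ℂ} (h : a + z ≠ 0) :
    ContDiffAt ℝ 1 (fun w => cutoffInv (a + w)) z :=
  ((contDiffAt_cutoffInv h).of_le (by norm_cast)).comp z
    (contDiffAt_const.add contDiffAt_id)

open Classical in
theorem exists_simplePole_eventuallyEq (L : PeriodPair) (z : ℂ) :
    ∃ g : ℂ → ℂ, ContDiffAt ℝ 1 g z ∧ simplePole L =ᶠ[𝓝[≠] z]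
      fun w => (if z ∈ L.lattice then 1 else 0) / (w - z) + g w := by
  obtain ⟨T, hT, hTz⟩ := simplePole_eventuallyEq_sum L z
  have hTz' := hTz.filter_mono (nhdsWithin_le_nhds (s := {z}ᶜ))
  by_cases hz : z ∈ L.lattice
  · set m : L.lattice := -⟨z, hz⟩ with hm
    have hmz : (m : ℂ) = -z := rfl
    have hmT : m ∈ T := by
      by_contra hcon
      have := hT m hcon
      rw [hmz, neg_add_cancel, norm_zero] at this
      norm_num at this
    refine ⟨fun w => ∑ l ∈ T.erase m, cutoffInv (l + w), ContDiffAt.sum fun l hl => ?_, ?_⟩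
    · refine contDiffAt_cutoffInv_add fun h0 => (Finset.mem_erase.1 hl).1 (Subtype.ext ?_)
      rw [hmz]
      exact eq_neg_of_add_eq_zero_left h0
    · have h1 : Tendsto (fun w => -z + w) (𝓝 z) (𝓝 0) := by
        have : ContinuousAt (fun w => -z + w) z := by fun_prop
        simpa [ContinuousAt] using this
      filter_upwards [hTz', (h1.eventually cutoffInv_eventuallyEq).filter_mono
        nhdsWithin_le_nhds] with w hw hw1
      rw [hw, ← Finset.add_sum_erase T _ hmT, hmz, hw1, if_pos hz, one_div, neg_add_eq_sub]
  · refine ⟨fun w => ∑ l ∈ T, cutoffInv (l + w), ContDiffAt.sum fun l hl => ?_, ?_⟩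
    · refine contDiffAt_cutoffInv_add fun h0 => hz ?_
      rw [eq_neg_of_add_eq_zero_right h0]
      exact neg_mem l.2
    · filter_upwards [hTz'] with w hw
      rw [hw, if_neg hz, zero_div, zero_add]

theorem differentiableAt_simplePole (L : PeriodPair) {z : ℂ} (hz : z ∉ L.lattice) :
    DifferentiableAt ℝ (simplePole L) z ∧
      dbar (simplePole L) z = ∑' l : L.lattice, cutoffInvDbar (l + z) := by
  obtain ⟨T, hT, hTz⟩ := simplePole_eventuallyEq_sum L z
  have h0 : ∀ l : L.lattice, (l : ℂ) + z ≠ 0 := fun l h0 => hz <| by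
    rw [eq_neg_of_add_eq_zero_right h0]
    exact neg_mem l.2
  have hd : ∀ l ∈ T, DifferentiableAt ℝ (fun w : ℂ => cutoffInv (l + w)) z := fun l _ =>
    (contDiffAt_cutoffInv_add (h0 l)).differentiableAt one_ne_zero
  refine ⟨hTz.differentiableAt_iff.2 (DifferentiableAt.fun_sum hd), ?_⟩
  rw [dbar_congr hTz, dbar_sum hd, tsum_eq_sum fun l hl => cutoffInvDbar_of_two_le (hT l hl)]
  exact Finset.sum_congr rfl fun l _ => by
    rw [dbar_comp_add_const, dbar_cutoffInv (h0 l)]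

theorem eventually_notMem_lattice (L : PeriodPair) (z : ℂ) : ∀ᶠ w in 𝓝[≠] z, w ∉ L.lattice := by
  filter_upwards [mem_nhdsWithin_of_mem_nhds (L.compl_lattice_sdiff_singleton_mem_nhds z),
    self_mem_nhdsWithin] with w hw hwz hwL
  exact hw ⟨hwL, hwz⟩

/-- `∫ ∂/∂z̄ (simplePole) = -π` over the torus: this is the Cauchy-Pompeiu formula, or
`∂/∂z̄ (1 / z) = π δ₀`. -/
theorem integral_dbar_simplePole (L : PeriodPair) :
    IntegrableOn (dbar (simplePole L)) (ZSpan.fundamentalDomain L.basis) ∧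
      ∫ z in ZSpan.fundamentalDomain L.basis, dbar (simplePole L) z = -Real.pi := by
  obtain ⟨T, hT⟩ := exists_finset_lattice L (ZSpan.fundamentalDomain_isBounded L.basis)
  have hmeas : MeasurableSet (ZSpan.fundamentalDomain L.basis) :=
    ZSpan.fundamentalDomain_measurableSet L.basis
  have hae : dbar (simplePole L) =ᵐ[volume.restrict (ZSpan.fundamentalDomain L.basis)]
      fun z => ∑ l ∈ T, cutoffInvDbar (l + z) := by
    have h1 : ∀ᵐ z : ℂ, z ∉ L.lattice :=
      ae_of_forall_eventually_nhdsNE (eventually_notMem_lattice L)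
    filter_upwards [ae_restrict_of_ae h1, ae_restrict_mem hmeas] with z hz hzF
    rw [(differentiableAt_simplePole L hz).2,
      tsum_eq_sum fun l hl => cutoffInvDbar_of_two_le (hT z hzF l hl)]
  have hi : ∀ l : L.lattice, IntegrableOn (fun z => cutoffInvDbar (l + z))
      (ZSpan.fundamentalDomain L.basis) := fun l =>
    (integrable_cutoffInvDbar.comp_add_left (l : ℂ)).integrableOn
  refine ⟨(integrable_congr hae).2 (integrable_finsetSum _ fun l _ => hi l), ?_⟩
  rw [integral_congr_ae hae, integral_finsetSum _ fun l _ => hi l, ← integral_cutoffInvDbar,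
    (isAddFundamentalDomain_lattice L).integral_eq_tsum'' _ integrable_cutoffInvDbar]
  refine (tsum_eq_sum fun l hl => ?_).symm
  exact setIntegral_eq_zero_of_forall_eq_zero fun z hz =>
    cutoffInvDbar_of_two_le (hT z hz l hl)

/-! ### The residue theorem on the torus -/

/-- The residue theorem on the torus, for functions that are not necessarily holomorphic:
if the periodic function `F` is `C¹` apart from simple poles with residues `c`, then
`∫ ∂F/∂z̄ = -π ∑ c`, where the sum is over representatives `S` of the poles. -/
theorem integral_dbar_eq_sum_residues {L : PeriodPair} {F c : ℂ → ℂ} (hF : IsPeriodic L F)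
    (hc : IsPeriodic L c) (S : Finset ℂ)
    (hS : ∀ p ∈ S, ∀ q ∈ S, p - q ∈ L.lattice → p = q)
    (hcS : ∀ z, c z ≠ 0 → ∃ p ∈ S, z - p ∈ L.lattice)
    (h : ∀ z, ∃ g : ℂ → ℂ, ContDiffAt ℝ 1 g z ∧ F =ᶠ[𝓝[≠] z] fun w => c z / (w - z) + g w) :
    IntegrableOn (dbar F) (ZSpan.fundamentalDomain L.basis) ∧
      ∫ z in ZSpan.fundamentalDomain L.basis, dbar F z = -Real.pi * ∑ p ∈ S, c p := by
  classical
  set H : ℂ → ℂ := fun z => ∑ p ∈ S, c p * simplePole L (-p + z) with hH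
  have hHp : IsPeriodic L H := fun l hl z => Finset.sum_congr rfl fun p _ => by
    rw [add_left_comm, isPeriodic_simplePole L l hl]
  have hshift := fun p z : ℂ => tendsto_add_left_nhdsNE (-p) z
  -- the poles of `H` are those of `F`
  have hHz : ∀ z, ∃ g : ℂ → ℂ, ContDiffAt ℝ 1 g z ∧
      H =ᶠ[𝓝[≠] z] fun w => c z / (w - z) + g w := fun z => by
    choose g hg hgs using fun p => exists_simplePole_eventuallyEq L (-p + z)
    refine ⟨fun w => ∑ p ∈ S, c p * g p (-p + w), ContDiffAt.sum fun p _ =>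
      contDiffAt_const.mul ((hg p).comp z (contDiffAt_const.add contDiffAt_id)), ?_⟩
    have hsum : ∑ p ∈ S, c p * (if -p + z ∈ L.lattice then 1 else 0) = c z := by
      by_cases hex : ∃ p ∈ S, z - p ∈ L.lattice
      · obtain ⟨p, hp, hpz⟩ := hex
        rw [Finset.sum_eq_single_of_mem p hp, if_pos (by rwa [neg_add_eq_sub]), mul_one,
          ← hc _ hpz p, sub_add_cancel]
        intro q hq hqp
        rw [if_neg, mul_zero]
        intro hmem
        refine hqp (hS q hq p hp ?_)
        have := sub_mem hpz hmem
        rwa [neg_add_eq_sub, sub_sub_sub_cancel_left] at this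
      · have hcz : c z = 0 := by
          by_contra hne
          exact hex (hcS z hne)
        rw [hcz]
        refine Finset.sum_eq_zero fun p hp => ?_
        rw [if_neg, mul_zero]
        intro hmem
        exact hex ⟨p, hp, by rwa [neg_add_eq_sub] at hmem⟩
    have hall : ∀ᶠ w in 𝓝[≠] z, ∀ p ∈ S, simplePole L (-p + w) =
        (if -p + z ∈ L.lattice then 1 else 0) / (-p + w - (-p + z)) + g p (-p + w) :=
      (Finset.eventually_all S).2 fun p _ => (hshift p z).eventually (hgs p)
    filter_upwards [hall] with w hw
    rw [hH, ← hsum, Finset.sum_div, ← Finset.sum_add_distrib]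
    refine Finset.sum_congr rfl fun p hp => ?_
    rw [hw p hp, add_sub_add_left_eq_sub]
    ring
  have hGp : IsPeriodic L (fun z => F z - H z) := fun l hl z => by
    simp only [hF l hl z, hHp l hl z]
  obtain ⟨hGi, hG0⟩ := hGp.setIntegral_dbar_eq_zero fun z => by
    obtain ⟨g, hg, hgF⟩ := h z
    obtain ⟨g', hg', hgH⟩ := hHz z
    refine ⟨fun w => g w - g' w, hg.sub hg', ?_⟩
    filter_upwards [hgF, hgH] with w h1 h2
    rw [h1, h2]
    ring
  have hd : ∀ {K : ℂ → ℂ} {z : ℂ}, (∃ g : ℂ → ℂ, ContDiffAt ℝ 1 g z ∧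
      K =ᶠ[𝓝[≠] z] fun w => c z / (w - z) + g w) → ∀ᶠ w in 𝓝[≠] z, DifferentiableAt ℝ K w := by
    rintro K z ⟨g, hg, hK⟩
    have h1 : ∀ᶠ w in 𝓝 z, ContDiffAt ℝ 1 g w := hg.eventually (by simp)
    filter_upwards [eventually_nhdsNE_eventually_nhds hK, h1.filter_mono nhdsWithin_le_nhds,
      self_mem_nhdsWithin] with w hw hgw hwz
    refine (EventuallyEq.differentiableAt_iff hw).2 ?_
    have h2 : DifferentiableAt ℂ (fun w => c z / (w - z)) w :=
      (differentiableAt_const _).div (by fun_prop) (sub_ne_zero.2 hwz)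
    exact (h2.restrictScalars ℝ).add (hgw.differentiableAt one_ne_zero)
  have hnot : ∀ p z : ℂ, ∀ᶠ w in 𝓝[≠] z, -p + w ∉ L.lattice := fun p z =>
    (hshift p z).eventually (eventually_notMem_lattice L _)
  have hHint : IntegrableOn (dbar H) (ZSpan.fundamentalDomain L.basis) ∧
      ∫ z in ZSpan.fundamentalDomain L.basis, dbar H z = -Real.pi * ∑ p ∈ S, c p := by
    have hae : dbar H =ᵐ[volume.restrict (ZSpan.fundamentalDomain L.basis)]
        fun z => ∑ p ∈ S, c p * dbar (simplePole L) (-p + z) := by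
      refine ae_restrict_of_ae <| ae_of_forall_eventually_nhdsNE fun z => ?_
      have hall : ∀ᶠ w in 𝓝[≠] z, ∀ p ∈ S, -p + w ∉ L.lattice :=
        (Finset.eventually_all S).2 fun p _ => hnot p z
      filter_upwards [hall] with w hw
      have hdp : ∀ p ∈ S, DifferentiableAt ℝ (fun z => simplePole L (-p + z)) w := fun p hp =>
        (differentiableAt_simplePole L (hw p hp)).1.comp w (by fun_prop)
      rw [hH, dbar_sum fun p hp => (hdp p hp).const_mul _]
      refine Finset.sum_congr rfl fun p hp => ?_
      rw [dbar_const_mul _ (hdp p hp), dbar_comp_add_const]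
    obtain ⟨hi, hv⟩ := integral_dbar_simplePole L
    have hi' : ∀ p, IntegrableOn (fun z => dbar (simplePole L) (-p + z))
        (ZSpan.fundamentalDomain L.basis) := fun p => by
      have hper := (isPeriodic_simplePole L).dbar_right
      have h1 := isAddFundamentalDomain_lattice L
      have h2 : IsAddFundamentalDomain L.lattice (-p +ᵥ ZSpan.fundamentalDomain L.basis) :=
        h1.vadd_of_comm (-p)
      have h3 := (h1.integrableOn_iff h2 (f := dbar (simplePole L))
        (fun g x => hper g g.2 x)).1 hi
      have h4 := ((measurePreserving_add_left volume (-p)).integrableOn_comp_preimage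
        (measurableEmbedding_addLeft (-p))).2 h3
      have h5 : (fun x => -p + x) ⁻¹' (-p +ᵥ ZSpan.fundamentalDomain L.basis) =
          ZSpan.fundamentalDomain L.basis := by
        ext z
        simp [mem_vadd_set]
      rwa [h5] at h4
    refine ⟨(integrable_congr hae).2 (integrable_finsetSum _ fun p _ =>
      (hi' p).const_mul _), ?_⟩
    rw [integral_congr_ae hae, integral_finsetSum _ fun p _ => (hi' p).const_mul _,
      Finset.mul_sum]
    refine Finset.sum_congr rfl fun p _ => ?_
    rw [integral_const_mul, (isPeriodic_simplePole L).dbar_right.setIntegral_add_left, hv,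
      mul_comm]
  have hae : dbar F =ᵐ[volume.restrict (ZSpan.fundamentalDomain L.basis)]
      fun z => dbar (fun z => F z - H z) z + dbar H z := by
    refine ae_restrict_of_ae <| ae_of_forall_eventually_nhdsNE fun z => ?_
    filter_upwards [hd (h z), hd (hHz z)] with w h1 h2
    rw [dbar_sub h1 h2, sub_add_cancel]
  refine ⟨(integrable_congr hae).2 (hGi.add hHint.1), ?_⟩
  rw [integral_congr_ae hae, integral_add hGi hHint.1, hG0, hHint.2, zero_add]

/-! ### Divisors of elliptic functions -/

theorem proj_eq_proj_iff {L : PeriodPair} {z w : ℂ} : proj L z = proj L w ↔ z - w ∈ L.lattice := by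
  rw [proj, proj, QuotientAddGroup.eq_iff_sub_mem]
  rfl

theorem proj_surjective (L : PeriodPair) : Function.Surjective (proj L) :=
  QuotientAddGroup.mk_surjective

theorem proj_add_of_mem {L : PeriodPair} {l : ℂ} (hl : l ∈ L.lattice) (z : ℂ) :
    proj L (l + z) = proj L z := by
  rw [proj_eq_proj_iff, add_sub_cancel_right]
  exact hl

theorem isPeriodic_comp_proj {L : PeriodPair} {β : Type*} (f : Torus L → β) :
    IsPeriodic L fun z => f (proj L z) := fun l hl z => by
  simp only [proj_add_of_mem hl]

theorem eventually_proj_ne {L : PeriodPair} (P : Torus L) (z : ℂ) :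
    ∀ᶠ w in 𝓝[≠] z, proj L w ≠ P := by
  obtain ⟨p, rfl⟩ := proj_surjective L P
  filter_upwards [(tendsto_add_left_nhdsNE (-p) z).eventually
    (eventually_notMem_lattice L _)] with w hw
  rwa [Ne, proj_eq_proj_iff, ← neg_add_eq_sub]

/-- The residue theorem on the torus, for meromorphic functions with simple poles. -/
theorem sum_residues_eq_zero {L : PeriodPair} {F c : ℂ → ℂ} (hF : IsPeriodic L F)
    (hc : IsPeriodic L c) (S : Finset ℂ)
    (hS : ∀ p ∈ S, ∀ q ∈ S, p - q ∈ L.lattice → p = q)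
    (hcS : ∀ z, c z ≠ 0 → ∃ p ∈ S, z - p ∈ L.lattice)
    (h : ∀ z, ∃ g : ℂ → ℂ, AnalyticAt ℂ g z ∧ F =ᶠ[𝓝[≠] z] fun w => c z / (w - z) + g w) :
    ∑ p ∈ S, c p = 0 := by
  have key := (integral_dbar_eq_sum_residues hF hc S hS hcS fun z => by
    obtain ⟨g, hg, hgF⟩ := h z
    exact ⟨g, hg.contDiffAt.restrict_scalars ℝ, hgF⟩).2
  have h0 : ∫ z in ZSpan.fundamentalDomain L.basis, dbar F z = 0 := by
    refine integral_eq_zero_of_ae (ae_restrict_of_ae <| ae_of_forall_eventually_nhdsNE fun z => ?_)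
    obtain ⟨g, hg, hgF⟩ := h z
    filter_upwards [eventually_nhdsNE_eventually_nhds hgF,
      hg.eventually_analyticAt.filter_mono nhdsWithin_le_nhds, self_mem_nhdsWithin]
      with w hw hgw hwz
    rw [dbar_congr hw]
    have h1 : DifferentiableAt ℂ (fun w => c z / (w - z)) w :=
      (differentiableAt_const _).div (by fun_prop) (sub_ne_zero.2 hwz)
    exact dbar_of_differentiableAt (h1.add hgw.differentiableAt)
  rw [h0] at key
  have hpi : -(Real.pi : ℂ) ≠ 0 := neg_ne_zero.2 (Complex.ofReal_ne_zero.2 Real.pi_ne_zero)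
  exact (mul_eq_zero.1 key.symm).resolve_left hpi

theorem meromorphicOrderAt_lift_eq {L : PeriodPair} (f : Torus L → ℂ) {z w : ℂ}
    (h : proj L z = proj L w) :
    meromorphicOrderAt (lift f) z = meromorphicOrderAt (lift f) w := by
  have h1 : (fun u => lift f (u + (z - w))) = lift f := funext fun u => by
    rw [add_comm]
    exact isPeriodic_comp_proj f _ (proj_eq_proj_iff.1 h) u
  have h2 := meromorphicOrderAt_comp_add_const_eq_meromorphicOrderAt (c := z - w) (f := lift f)
    (x := w)
  rw [add_sub_cancel] at h2
  rw [← h2]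
  exact congrArg (meromorphicOrderAt · w) h1

theorem meromorphicOrderAt_ne_top_of_ne_top {L : PeriodPair} {f : Torus L → ℂ}
    (hf : IsMeromorphic f) {z : ℂ} (hz : meromorphicOrderAt (lift f) z ≠ ⊤) (w : ℂ) :
    meromorphicOrderAt (lift f) w ≠ ⊤ :=
  MeromorphicOn.meromorphicOrderAt_ne_top_of_isPreconnected (U := univ) (fun z _ => hf z)
    isPreconnected_univ (mem_univ z) (mem_univ w) hz

theorem eventually_meromorphicOrderAt_eq_zero {f : ℂ → ℂ} {z : ℂ} (hf : MeromorphicAt f z)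
    (hz : meromorphicOrderAt f z ≠ ⊤) : ∀ᶠ w in 𝓝[≠] z, meromorphicOrderAt f w = 0 := by
  have h1 := (meromorphicOrderAt_ne_top_iff_eventually_ne_zero hf).1 hz
  filter_upwards [hf.eventually_analyticAt, h1] with w hw hw0
  rw [hw.meromorphicOrderAt_eq, hw.analyticOrderAt_eq_zero.2 hw0]
  rfl

theorem finite_setOf_order_ne_zero {L : PeriodPair} {f : Torus L → ℂ} (hf : IsMeromorphic f)
    (htop : ∀ z, meromorphicOrderAt (lift f) z ≠ ⊤) :
    {q : Torus L | ∃ z, proj L z = q ∧ meromorphicOrderAt (lift f) z ≠ 0}.Finite := by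
  set s := {z | meromorphicOrderAt (lift f) z ≠ 0} ∩ ZSpan.fundamentalDomain L.basis with hs
  have hfin : s.Finite := by
    by_contra hinf
    have hcpt : IsCompact (closure (ZSpan.fundamentalDomain L.basis)) :=
      (ZSpan.fundamentalDomain_isBounded L.basis).isCompact_closure
    obtain ⟨x, -, hx⟩ := Set.Infinite.exists_accPt_of_subset_isCompact (s := s) hinf hcpt
      (inter_subset_right.trans subset_closure)
    rw [accPt_iff_frequently_nhdsNE] at hx
    refine hx ?_
    filter_upwards [eventually_meromorphicOrderAt_eq_zero (hf x) (htop x)] with w hw hws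
    exact hws.1 hw
  refine (hfin.image (proj L)).subset ?_
  rintro q ⟨z, rfl, hz⟩
  have h1 : proj L (ZSpan.fract L.basis z) = proj L z := by
    rw [proj_eq_proj_iff, ZSpan.fract_apply, sub_sub_cancel_left, L.lattice_eq_span_range_basis]
    exact neg_mem (ZSpan.floor L.basis z).2
  refine ⟨_, ⟨?_, ZSpan.fract_mem_fundamentalDomain L.basis z⟩, h1⟩
  rwa [mem_ofPred_eq, meromorphicOrderAt_lift_eq f h1]

theorem exists_hasDivisor {L : PeriodPair} {f : Torus L → ℂ} (hf : IsMeromorphic f)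
    (htop : ∀ z, meromorphicOrderAt (lift f) z ≠ ⊤) : ∃ D, HasDivisor f D := by
  set r := Function.surjInv (proj_surjective L) with hr
  have hrq : ∀ q, proj L (r q) = q := Function.surjInv_eq _
  refine ⟨Finsupp.ofSupportFinite (fun q => (meromorphicOrderAt (lift f) (r q)).untop₀)
    ((finite_setOf_order_ne_zero hf htop).subset fun q hq => ⟨r q, hrq q, fun h0 => hq ?_⟩),
    fun z => ?_⟩
  · simp [h0]
  · rw [Finsupp.ofSupportFinite_coe, meromorphicOrderAt_lift_eq f (hrq (proj L z)),
      WithTop.coe_untop₀_of_ne_top (htop z)]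

theorem logDeriv_eventuallyEq {f : ℂ → ℂ} {z : ℂ} {n : ℤ} (hf : MeromorphicAt f z)
    (hn : meromorphicOrderAt f z = n) : ∃ g : ℂ → ℂ, AnalyticAt ℂ g z ∧
      logDeriv f =ᶠ[𝓝[≠] z] fun w => n / (w - z) + g w := by
  obtain ⟨g, hg, hg0, hfg⟩ := (meromorphicOrderAt_eq_int_iff hf).1 hn
  refine ⟨fun w => deriv g w / g w, hg.deriv.div hg hg0, ?_⟩
  filter_upwards [eventually_nhdsNE_eventually_nhds hfg,
    hg.eventually_analyticAt.filter_mono nhdsWithin_le_nhds,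
    (hg.continuousAt.eventually_ne hg0).filter_mono nhdsWithin_le_nhds,
    self_mem_nhdsWithin] with w hw hgw hgw0 hwz
  have hwz' : w - z ≠ 0 := sub_ne_zero.2 hwz
  have h1 : HasDerivAt (fun u => (u - z) ^ n) (n * (w - z) ^ (n - 1)) w := by
    have := HasDerivAt.comp (h := fun u => u - z) w (hasDerivAt_zpow n (w - z) (Or.inl hwz'))
      ((hasDerivAt_id w).sub_const z)
    exact this.congr_deriv (mul_one _)
  have h2 := h1.mul hgw.differentiableAt.hasDerivAt
  simp only [smul_eq_mul] at hw
  rw [logDeriv_apply, EventuallyEq.deriv_eq hw, hw.self_of_nhds]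
  have h3 : deriv (fun u => (u - z) ^ n * g u) w =
      n * (w - z) ^ (n - 1) * g w + (w - z) ^ n * deriv g w := h2.deriv
  have h4 : (w - z) ^ n ≠ 0 := zpow_ne_zero _ hwz'
  rw [h3, zpow_sub_one₀ hwz']
  field_simp

/-- The divisor of an elliptic function has degree zero: the residues of the logarithmic derivative
are the orders of the function. -/
theorem HasDivisor.degree_eq_zero {L : PeriodPair} {f : Torus L → ℂ} {D : Torus L →₀ ℤ}
    (hf : IsMeromorphic f) (hD : HasDivisor f D) : ∑ q ∈ D.support, D q = 0 := by
  classical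
  set r := Function.surjInv (proj_surjective L) with hr
  have hrq : ∀ q, proj L (r q) = q := Function.surjInv_eq _
  have hinj : Function.Injective r := Function.injective_surjInv _
  have hper : IsPeriodic L (logDeriv (lift f)) := fun l hl z => by
    have h1 : (fun w => lift f (l + w)) = lift f := funext (isPeriodic_comp_proj f l hl)
    have h2 : deriv (lift f) (l + z) = deriv (lift f) z := by
      rw [← deriv_comp_const_add, h1]
    rw [logDeriv_apply, logDeriv_apply, h2]
    congr 1
    exact congrFun h1 z
  have key := sum_residues_eq_zero (c := fun z => (D (proj L z) : ℂ)) hper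
    (isPeriodic_comp_proj fun q => (D q : ℂ)) (D.support.image r)
    (fun p hp q hq hpq => by
      obtain ⟨p', -, rfl⟩ := Finset.mem_image.1 hp
      obtain ⟨q', -, rfl⟩ := Finset.mem_image.1 hq
      rw [← proj_eq_proj_iff, hrq, hrq] at hpq
      rw [hpq])
    (fun z hz => ⟨r (proj L z), Finset.mem_image_of_mem _ (Finsupp.mem_support_iff.2 fun h0 =>
      hz (by simp [h0])), proj_eq_proj_iff.1 (hrq _).symm⟩)
    (fun z => logDeriv_eventuallyEq (hf z) (hD z))
  rw [Finset.sum_image fun x _ y _ h => hinj h] at key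
  simp only [hrq] at key
  exact_mod_cast key

/-- There is no elliptic function with a single pole, which is simple: its residue would be
nonzero. -/
theorem not_single_simple_pole {L : PeriodPair} {f : ℂ → ℂ} (hper : IsPeriodic L f)
    (hf : ∀ z, MeromorphicAt f z) {p : ℂ} (hp : meromorphicOrderAt f p = (-1 : ℤ))
    (h : ∀ z, proj L z ≠ proj L p → 0 ≤ meromorphicOrderAt f z) : False := by
  classical
  obtain ⟨g, hg, hg0, hfg⟩ := (meromorphicOrderAt_eq_int_iff (hf p)).1 hp
  have key := sum_residues_eq_zero (F := f)
    (c := fun z => if proj L z = proj L p then g p else 0) hper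
    (isPeriodic_comp_proj fun q => if q = proj L p then g p else 0) {p}
    (by simp) (fun z hz => ⟨p, by simp, proj_eq_proj_iff.1 (by by_contra hne; simp [hne] at hz)⟩)
    (fun z => ?_)
  · simp [hg0] at key
  · by_cases hz : proj L z = proj L p
    · have hl := proj_eq_proj_iff.1 hz.symm
      have hshift := tendsto_add_left_nhdsNE (p - z) z
      rw [sub_add_cancel] at hshift
      refine ⟨fun w => dslope g p (p - z + w), ?_, ?_⟩
      · have h1 : AnalyticAt ℂ (dslope g p) p := by
          obtain ⟨q, hq⟩ := hg
          exact ⟨q.fslope, hq.has_fpower_series_dslope_fslope⟩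
        have h2 : AnalyticAt ℂ (fun w => p - z + w) z := by fun_prop
        exact AnalyticAt.fun_comp (by simpa using h1) h2
      · filter_upwards [hshift.eventually hfg, self_mem_nhdsWithin] with w hw hwz
        have hwz' : w - z ≠ 0 := sub_ne_zero.2 hwz
        have hne : p - z + w ≠ p := fun h0 => hwz' (by linear_combination h0)
        rw [hper _ hl] at hw
        simp only [if_pos hz]
        have h3 : p - z + w - p = w - z := by ring
        rw [hw, dslope_of_ne _ hne, slope_def_field, h3, smul_eq_mul, zpow_neg_one]
        field_simp
        ring
    · have h1 := (hf z).meromorphicOrderAt_nonneg_iff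
      obtain ⟨g', hg', hgf⟩ := h1.1 (h z hz)
      refine ⟨g', hg', ?_⟩
      filter_upwards [hgf] with w hw
      simp [hz, hw]

/-! ### Effective divisors of degree two -/

theorem exists_eq_single {α : Type*} {N : α →₀ ℕ} (h : N.degree = 1) :
    ∃ A, N = Finsupp.single A 1 := by
  classical
  have h1 : Multiset.card (Finsupp.toMultiset N) = 1 := by
    rw [Finsupp.card_toMultiset, ← h]
    rfl
  obtain ⟨A, hA⟩ := Multiset.card_eq_one.1 h1
  refine ⟨A, ?_⟩
  rw [← Finsupp.toMultiset_toFinsupp N, hA, Multiset.toFinsupp_singleton]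

theorem exists_eq_single_add_single {α : Type*} {N : α →₀ ℕ} (h : N.degree = 2) :
    ∃ A B, N = Finsupp.single A 1 + Finsupp.single B 1 := by
  classical
  have h1 : Multiset.card (Finsupp.toMultiset N) = 2 := by
    rw [Finsupp.card_toMultiset, ← h]
    rfl
  obtain ⟨A, B, hAB⟩ := Multiset.card_eq_two.1 h1
  refine ⟨A, B, ?_⟩
  rw [← Finsupp.toMultiset_toFinsupp N, hAB, Multiset.insert_eq_cons, ← Multiset.singleton_add,
    map_add, Multiset.toFinsupp_singleton, Multiset.toFinsupp_singleton]

theorem exists_eq_of_apply_eq_zero {α : Type*} {N : α →₀ ℕ} (h : N.degree = 2) {P : α}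
    (hP : N P = 0) : ∃ A B, A ≠ P ∧ B ≠ P ∧ N = Finsupp.single A 1 + Finsupp.single B 1 := by
  obtain ⟨A, B, rfl⟩ := exists_eq_single_add_single h
  refine ⟨A, B, ?_, ?_, rfl⟩ <;> rintro rfl <;> simp at hP

theorem exists_eq_of_apply_eq_one {α : Type*} {N : α →₀ ℕ} (h : N.degree = 2) {P : α}
    (hP : N P = 1) : ∃ A, A ≠ P ∧ N = Finsupp.single P 1 + Finsupp.single A 1 := by
  obtain ⟨A, B, rfl⟩ := exists_eq_single_add_single h
  by_cases hA : A = P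
  · subst hA
    refine ⟨B, ?_, rfl⟩
    rintro rfl
    simp at hP
  · by_cases hB : B = P
    · subst hB
      exact ⟨A, hA, add_comm _ _⟩
    · simp [hA, hB] at hP

theorem eq_of_apply_eq_two {α : Type*} {N : α →₀ ℕ} (h : N.degree = 2) {P : α}
    (hP : N P = 2) : N = Finsupp.single P 1 + Finsupp.single P 1 := by
  obtain ⟨A, B, rfl⟩ := exists_eq_single_add_single h
  by_cases hA : A = P <;> by_cases hB : B = P <;> simp_all

/-! ### The Gauss-Bonnet formula -/

/-- The derivative `∂u/∂z = (∂u/∂x - i ∂u/∂y) / 2` of a real function `u`. -/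
noncomputable def delReal (u : ℂ → ℝ) (z : ℂ) : ℂ :=
  ((fderiv ℝ u z 1 : ℂ) - Complex.I * (fderiv ℝ u z Complex.I : ℂ)) / 2

theorem delReal_congr {u v : ℂ → ℝ} {z : ℂ} (h : u =ᶠ[𝓝 z] v) : delReal u z = delReal v z := by
  simp only [delReal, h.fderiv_eq]

theorem contDiffAt_delReal {u : ℂ → ℝ} {z : ℂ} (h : ContDiffAt ℝ 2 u z) :
    ContDiffAt ℝ 1 (delReal u) z := by
  have h1 : ContDiffAt ℝ 1 (fderiv ℝ u) z := h.fderiv_right (by norm_num)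
  have h2 : ∀ v : ℂ, ContDiffAt ℝ 1 (fun w => (fderiv ℝ u w v : ℂ)) z := fun v =>
    Complex.ofRealCLM.contDiff.contDiffAt.comp z (h1.clm_apply contDiffAt_const)
  exact ((h2 1).sub (contDiffAt_const.mul (h2 Complex.I))).div_const 2

/-- `4 ∂²u/∂z̄∂z = Δu`. -/
theorem re_dbar_delReal {u : ℂ → ℝ} {z : ℂ} (h : ContDiffAt ℝ 2 u z) :
    (dbar (delReal u) z).re = Laplacian.laplacian u z / 4 := by
  have h1 : HasFDerivAt (fderiv ℝ u) (fderiv ℝ (fderiv ℝ u) z) z :=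
    ((h.fderiv_right (m := 1) (by norm_num)).differentiableAt one_ne_zero).hasFDerivAt
  have h2 : ∀ v : ℂ, HasFDerivAt (fun w => (fderiv ℝ u w v : ℂ))
      ((Complex.ofRealCLM.comp (ContinuousLinearMap.apply ℝ ℝ v)).comp
        (fderiv ℝ (fderiv ℝ u) z)) z := fun v =>
    (Complex.ofRealCLM.comp (ContinuousLinearMap.apply ℝ ℝ v)).hasFDerivAt.comp z h1
  have h3 := ((h2 1).fun_sub ((h2 Complex.I).const_mul Complex.I)).mul_const (2⁻¹ : ℂ)
  have h4 : delReal u = fun w => ((fderiv ℝ u w 1 : ℂ) -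
      Complex.I * (fderiv ℝ u w Complex.I : ℂ)) * 2⁻¹ := funext fun w => div_eq_mul_inv _ _
  rw [← h4] at h3
  rw [dbar, h3.fderiv, InnerProductSpace.laplacian_eq_iteratedFDeriv_complexPlane]
  simp [iteratedFDeriv_two_apply]
  ring

theorem delReal_add {u v : ℂ → ℝ} {z : ℂ} (hu : DifferentiableAt ℝ u z)
    (hv : DifferentiableAt ℝ v z) :
    delReal (fun w => u w + v w) z = delReal u z + delReal v z := by
  simp only [delReal, fderiv_fun_add hu hv, add_apply]
  push_cast
  ring

/-- `∂/∂z log |z|² = 1 / z`. -/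
theorem delReal_mul_log_normSq {z w : ℂ} (m : ℝ) (h : w ≠ z) :
    DifferentiableAt ℝ (fun w => m * Real.log (Complex.normSq (w - z))) w ∧
      delReal (fun w => m * Real.log (Complex.normSq (w - z))) w = m / (w - z) := by
  have h0 : w - z ≠ 0 := sub_ne_zero.2 h
  have hn : Complex.normSq (w - z) ≠ 0 := by simpa using h0
  have h1 : HasFDerivAt (fun w => Complex.normSq (w - z)) _ w :=
    (hasFDerivAt_normSq (w - z)).comp w ((hasFDerivAt_id w).sub_const z)
  have h2 := (h1.log hn).const_mul m
  refine ⟨h2.differentiableAt, ?_⟩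
  rw [delReal, h2.fderiv, eq_div_iff h0]
  have h3 := Complex.mul_conj (w - z)
  have hn' : (Complex.normSq (w - z) : ℂ) ≠ 0 := Complex.ofReal_ne_zero.2 hn
  have h4 : (starRingEnd ℂ) (w - z) = (w - z).re - Complex.I * (w - z).im := by
    apply Complex.ext <;> simp [neg_add_eq_sub]
  rw [h4] at h3
  simp only [smul_apply, ContinuousLinearMap.comp_apply, add_apply, smul_eq_mul,
    Complex.reCLM_apply, Complex.imCLM_apply, Complex.one_re, Complex.one_im, Complex.I_re,
    Complex.I_im, ContinuousLinearMap.id_apply]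
  push_cast
  field_simp
  linear_combination (m : ℂ) * h3

/-- Gauss-Bonnet for a periodic conformal factor `E`, smooth and positive away from the lattice
points over `P`, where `E = |z|^{2m} V` with smooth positive `V`: the integral of `Δ log E` over
the torus is `-4π m`. -/
theorem integral_laplacian_log {L : PeriodPair} {P : Torus L} {E : ℂ → ℝ}
    (hE : IsPeriodic L E)
    (hsmooth : ∀ z ∈ punctured P, ContDiffAt ℝ 2 E z ∧ 0 < E z) (m : ℤ)
    (hP : ∀ z, proj L z = P → ∃ V : ℂ → ℝ, ContDiffAt ℝ 2 V z ∧ 0 < V z ∧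
      E =ᶠ[𝓝[≠] z] fun w => Complex.normSq (w - z) ^ m * V w) :
    ∫ z in ZSpan.fundamentalDomain L.basis,
      Laplacian.laplacian (fun w => Real.log (E w)) z = -4 * Real.pi * m := by
  classical
  obtain ⟨p, hp⟩ := proj_surjective L P
  set u : ℂ → ℝ := fun w => Real.log (E w) with hu
  have huz : ∀ z ∈ punctured P, ContDiffAt ℝ 2 u z := fun z hz =>
    (hsmooth z hz).1.log (hsmooth z hz).2.ne'
  have hper : IsPeriodic L (delReal u) := fun l hl z => by
    have h1 : IsPeriodic L u := fun l hl w => by simp only [hu, hE l hl w]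
    simp only [delReal, h1.fderiv_right l hl z]
  have key := integral_dbar_eq_sum_residues (F := delReal u)
    (c := fun z => if proj L z = P then (m : ℂ) else 0) hper
    (isPeriodic_comp_proj fun q => if q = P then (m : ℂ) else 0) {p} (by simp)
    (fun z hz => ⟨p, by simp, proj_eq_proj_iff.1 (by
      rw [hp]
      by_contra hne
      simp [hne] at hz)⟩)
    (fun z => by
      by_cases hz : proj L z = P
      · obtain ⟨V, hV, hV0, hEV⟩ := hP z hz
        refine ⟨delReal fun w => Real.log (V w), contDiffAt_delReal (hV.log hV0.ne'), ?_⟩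
        have hVpos : ∀ᶠ w in 𝓝[≠] z, 0 < V w :=
          (hV.continuousAt.eventually (lt_mem_nhds hV0)).filter_mono nhdsWithin_le_nhds
        have hVd : ∀ᶠ w in 𝓝[≠] z, ContDiffAt ℝ 2 V w :=
          (hV.eventually (by simp)).filter_mono nhdsWithin_le_nhds
        have hlog : ∀ᶠ w in 𝓝[≠] z,
            u w = m * Real.log (Complex.normSq (w - z)) + Real.log (V w) := by
          filter_upwards [hEV, hVpos, self_mem_nhdsWithin] with w h1 h2 h3
          have hn : Complex.normSq (w - z) ≠ 0 := by simpa using sub_ne_zero.2 h3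
          rw [hu]
          simp only
          rw [h1, Real.log_mul (zpow_ne_zero _ hn) h2.ne', Real.log_zpow]
        filter_upwards [eventually_nhdsNE_eventually_nhds hlog, hVpos, hVd, self_mem_nhdsWithin]
          with w h1 h2 h3 h4
        obtain ⟨h5, h6⟩ := delReal_mul_log_normSq (m : ℝ) h4
        rw [delReal_congr h1, delReal_add h5
          ((h3.log h2.ne').differentiableAt two_ne_zero), h6, if_pos hz]
        simp
      · refine ⟨delReal u, contDiffAt_delReal (huz z hz), Eventually.of_forall fun w => ?_⟩
        simp [hz])
  obtain ⟨hint, hval⟩ := key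
  have hae : (fun z => Laplacian.laplacian u z)
      =ᵐ[volume.restrict (ZSpan.fundamentalDomain L.basis)]
      fun z => 4 * (dbar (delReal u) z).re := by
    refine ae_restrict_of_ae <| ae_of_forall_eventually_nhdsNE fun z => ?_
    filter_upwards [eventually_proj_ne P z] with w hw
    rw [re_dbar_delReal (huz w hw)]
    ring
  have hre : ∫ z in ZSpan.fundamentalDomain L.basis, (dbar (delReal u) z).re = -Real.pi * m := by
    have h1 := integral_re (𝕜 := ℂ) hint
    simp only [RCLike.re_eq_complex_re] at h1
    rw [h1, hval]
    simp [hp]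
  rw [integral_congr_ae hae, integral_const_mul, hre]
  ring

/-! ### The induced metric of a surface with Weierstrass data -/

/-- The metric `⟨dX, dX⟩` is `4 |φ - ψ̄|² |dh|²`. -/
theorem lorentz_re_weierstrassForm (a b c : ℂ) :
    lorentz (fun i => 2 * (weierstrassForm a b c i * 1).re)
      (fun i => 2 * (weierstrassForm a b c i * 1).re) =
      4 * Complex.normSq c * Complex.normSq (a - (starRingEnd ℂ) b) := by
  simp [lorentz, weierstrassForm, Complex.normSq_apply]
  ring

theorem punctured_mem_nhds {L : PeriodPair} {P : Torus L} {z : ℂ} (hz : z ∈ punctured P) :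
    punctured P ∈ 𝓝 z := by
  have h := eventually_nhdsWithin_iff.1 (eventually_proj_ne P z)
  filter_upwards [h] with w hw
  by_cases hwz : w = z
  · rwa [hwz]
  · exact hw hwz

theorem contDiffAt_conformalFactor {L : PeriodPair} {P : Torus L} {X : Torus L → Fin 4 → ℝ}
    (hX : IsConformalSpacelikeImmersion P X) {z : ℂ} (hz : z ∈ punctured P) :
    ContDiffAt ℝ 2 (conformalFactor X) z := by
  have h1 : ContDiffAt ℝ 2 (fderiv ℝ (lift X)) z :=
    (hX.smooth.contDiffAt (punctured_mem_nhds hz)).fderiv_right (by norm_cast)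
  have h2 : ContDiffAt ℝ 2 (fun w => fderiv ℝ (lift X) w 1) z := h1.clm_apply contDiffAt_const
  have h3 : ∀ i, ContDiffAt ℝ 2 (fun w => fderiv ℝ (lift X) w 1 i) z := contDiffAt_pi.1 h2
  exact ((((h3 0).mul (h3 0)).add ((h3 1).mul (h3 1))).add ((h3 2).mul (h3 2))).sub
    ((h3 3).mul (h3 3))

theorem isPeriodic_conformalFactor {L : PeriodPair} (X : Torus L → Fin 4 → ℝ) :
    IsPeriodic L (conformalFactor X) := fun l hl z => by
  have h : IsPeriodic L (lift X) := isPeriodic_comp_proj X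
  simp only [conformalFactor, inducedMetric, h.fderiv_right l hl z]

theorem conformalFactor_eventuallyEq {L : PeriodPair} {P : Torus L} {X : Torus L → Fin 4 → ℝ}
    {φ ψ h : Torus L → ℂ} (hX : IsWeierstrassData P X φ ψ h) (z : ℂ) :
    conformalFactor X =ᶠ[𝓝[≠] z] fun w => 4 * Complex.normSq (lift h w) *
      Complex.normSq (lift φ w - (starRingEnd ℂ) (lift ψ w)) := by
  filter_upwards [eventually_proj_ne P z, (hX.meromorphic_φ z).eventually_analyticAt,
    (hX.meromorphic_ψ z).eventually_analyticAt, (hX.meromorphic_h z).eventually_analyticAt]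
    with w h1 h2 h3 h4
  rw [conformalFactor, inducedMetric, hX.representation w h1 h2 h3 h4 1,
    lorentz_re_weierstrassForm]

theorem contDiff_conj : ContDiff ℝ 2 (starRingEnd ℂ) := Complex.conjCLE.contDiff

/-- If `φ` has a zero and `ψ` a pole of order `b` at `z`, then `|h|² |φ - ψ̄|²` behaves like
`|h ψ|²`, up to a smooth positive factor. -/
theorem exists_metric_factor {φ ψ h : ℂ → ℂ} {z : ℂ} {a b : ℕ} {n : ℤ} (ha : a ≠ 0)
    (hφm : MeromorphicAt φ z) (hψm : MeromorphicAt ψ z) (hhm : MeromorphicAt h z)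
    (hφ : meromorphicOrderAt φ z = (a : ℤ)) (hψ : meromorphicOrderAt ψ z = (-(b : ℤ) : ℤ))
    (hh : meromorphicOrderAt h z = n) :
    ∃ V : ℂ → ℝ, ContDiffAt ℝ 2 V z ∧ 0 < V z ∧
      (fun w => 4 * Complex.normSq (h w) * Complex.normSq (φ w - (starRingEnd ℂ) (ψ w)))
        =ᶠ[𝓝[≠] z] fun w => Complex.normSq (w - z) ^ (n - b) * V w := by
  obtain ⟨g₁, hg₁, -, hφg⟩ := (meromorphicOrderAt_eq_int_iff hφm).1 hφ
  obtain ⟨g₂, hg₂, hg₂0, hψg⟩ := (meromorphicOrderAt_eq_int_iff hψm).1 hψ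
  obtain ⟨g₃, hg₃, hg₃0, hhg⟩ := (meromorphicOrderAt_eq_int_iff hhm).1 hh
  have hc : ∀ {g : ℂ → ℂ}, AnalyticAt ℂ g z → ContDiffAt ℝ 2 g z := fun hg =>
    hg.contDiffAt.restrict_scalars ℝ
  have hconj : ∀ {g : ℂ → ℂ}, ContDiffAt ℝ 2 g z →
      ContDiffAt ℝ 2 (fun w => (starRingEnd ℂ) (g w)) z := fun hg =>
    contDiff_conj.contDiffAt.comp z hg
  have hn : ∀ {g : ℂ → ℂ}, ContDiffAt ℝ 2 g z →
      ContDiffAt ℝ 2 (fun w => Complex.normSq (g w)) z := fun hg =>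
    (contDiff_normSq.of_le (by norm_cast)).contDiffAt.comp z hg
  have hs : ContDiffAt ℝ 2 (fun w : ℂ => w - z) z := contDiffAt_id.sub contDiffAt_const
  refine ⟨fun w => 4 * Complex.normSq (g₃ w) * Complex.normSq ((w - z) ^ a * g₁ w *
    (starRingEnd ℂ) ((w - z) ^ b) - (starRingEnd ℂ) (g₂ w)), ?_, ?_, ?_⟩
  · exact (contDiffAt_const.mul (hn (hc hg₃))).mul
      (hn ((((hs.pow a).mul (hc hg₁)).mul (hconj (hs.pow b))).sub (hconj (hc hg₂))))
  · simp [ha, hg₂0, hg₃0]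
  · filter_upwards [hφg, hψg, hhg, self_mem_nhdsWithin] with w h1 h2 h3 h4
    have h5 : w - z ≠ 0 := sub_ne_zero.2 h4
    have h6 : Complex.normSq (w - z) ≠ 0 := by simpa using h5
    have h7 : (starRingEnd ℂ) (w - z) ^ b ≠ 0 := pow_ne_zero _ ((map_ne_zero _).2 h5)
    have h8 : (w - z) ^ a * g₁ w - (starRingEnd ℂ) ((w - z) ^ (-(b : ℤ)) * g₂ w) =
        (starRingEnd ℂ) ((w - z) ^ (-(b : ℤ))) * ((w - z) ^ a * g₁ w *
          (starRingEnd ℂ) ((w - z) ^ b) - (starRingEnd ℂ) (g₂ w)) := by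
      simp only [map_mul, zpow_neg, zpow_natCast, map_inv₀, map_pow]
      field_simp
    simp only [smul_eq_mul, zpow_natCast] at h1 h2 h3
    rw [h1, h2, h3, h8, map_mul, map_mul, map_zpow₀, Complex.normSq_conj, map_zpow₀,
      zpow_sub₀ h6, zpow_neg, zpow_natCast]
    field_simp

/-- The Gauss-Bonnet theorem: a total curvature of `8π` means that the metric has a pole of order
`4` at the end, i.e. that `ψ dh` has order `-4` there. -/
theorem order_add_order_eq_neg_four {L : PeriodPair} {P : Torus L} {X : Torus L → Fin 4 → ℝ}
    {φ ψ h : Torus L → ℂ} (hX : IsCompleteAlgebraicStationary P X φ ψ h)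
    (hcurv : HasTotalCurvature X (8 * Real.pi)) {Dφ Dψ Dh : Torus L →₀ ℤ}
    (hφ : HasDivisor φ Dφ) (hψ : HasDivisor ψ Dψ) (hh : HasDivisor h Dh)
    (hφP : 0 < Dφ P) (hψP : Dψ P < 0) : Dh P + Dψ P = -4 := by
  have hspace := hX.stationary.toIsConformalSpacelikeImmersion
  obtain ⟨a, ha⟩ := Int.eq_ofNat_of_zero_le hφP.le
  obtain ⟨b, hb⟩ := Int.eq_ofNat_of_zero_le (neg_nonneg.2 hψP.le)
  have key := integral_laplacian_log (P := P) (isPeriodic_conformalFactor X)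
    (fun z hz => ⟨contDiffAt_conformalFactor hspace hz, hspace.spacelike z hz⟩)
    (Dh P + Dψ P) fun z hz => by
      obtain ⟨V, hV, hV0, hVE⟩ := exists_metric_factor (a := a) (b := b) (n := Dh P) (by omega)
        (hX.data.meromorphic_φ z) (hX.data.meromorphic_ψ z) (hX.data.meromorphic_h z)
        (by rw [hφ z, hz, ha]) (by rw [hψ z, hz, ← hb, neg_neg]) (by rw [hh z, hz])
      refine ⟨V, hV, hV0, (conformalFactor_eventuallyEq hX.data z).trans ?_⟩
      rwa [← hb, sub_neg_eq_add] at hVE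
  have hae : curvatureDensity X =ᵐ[volume.restrict (ZSpan.fundamentalDomain L.basis)]
      fun z => -(1 / 2) * Laplacian.laplacian (fun w => Real.log (conformalFactor X w)) z := by
    refine ae_restrict_of_ae <| ae_of_forall_eventually_nhdsNE fun z => ?_
    filter_upwards [eventually_proj_ne P z] with w hw
    have := hspace.spacelike w hw
    rw [curvatureDensity, gaussCurvature]
    field_simp
  have h1 := hcurv.2
  rw [integral_congr_ae hae, integral_const_mul, key] at h1
  have h2 : ((Dh P + Dψ P : ℤ) : ℝ) = -4 := by
    have hpi := Real.pi_ne_zero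
    have h3 : Real.pi * (((Dh P + Dψ P : ℤ) : ℝ) + 4) = 0 := by linear_combination (-1 / 2) * h1
    linarith [(mul_eq_zero.1 h3).resolve_left hpi]
  exact_mod_cast h2

/-! ### Values on the sphere -/

theorem sphereValue_of_pos {f : ℂ → ℂ} {z : ℂ} (h : 0 < meromorphicOrderAt f z) :
    sphereValue f z = ((0 : ℂ) : OnePoint ℂ) := by
  rw [sphereValue, if_neg h.le.not_gt, (tendsto_zero_of_meromorphicOrderAt_pos h).limUnder_eq]

theorem order_pos_of_sphereValue_eq_zero {f : ℂ → ℂ} {z : ℂ} (hf : MeromorphicAt f z)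
    (h : sphereValue f z = ((0 : ℂ) : OnePoint ℂ)) : 0 < meromorphicOrderAt f z := by
  rw [sphereValue] at h
  split_ifs at h with h0
  · exact absurd h (OnePoint.infty_ne_coe _)
  · obtain ⟨c, hc⟩ := tendsto_nhds_of_meromorphicOrderAt_nonneg hf (not_lt.1 h0)
    rw [OnePoint.coe_eq_coe, hc.limUnder_eq] at h
    rw [h] at hc
    exact (tendsto_zero_iff_meromorphicOrderAt_pos hf).1 hc

theorem order_neg_of_sphereValue_eq_infty {f : ℂ → ℂ} {z : ℂ}
    (h : sphereValue f z = OnePoint.infty) : meromorphicOrderAt f z < 0 := by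
  rw [sphereValue] at h
  split_ifs at h with h0
  · exact h0
  · exact absurd h (OnePoint.coe_ne_infty _)

theorem poleOrder_eq {L : PeriodPair} {f : Torus L → ℂ} {D : Torus L →₀ ℤ} (h : HasDivisor f D)
    (z : ℂ) : poleOrder (lift f) z = (-D (proj L z)).toNat := by
  rw [poleOrder, h z, WithTop.untop₀_coe]

/-! ### Zero and polar divisors -/

/-- The polar part of a divisor, an effective divisor. -/
noncomputable def polarPart {α : Type*} (D : α →₀ ℤ) : α →₀ ℕ :=
  D.mapRange (fun n => (-n).toNat) (by simp)

theorem polarPart_apply {α : Type*} (D : α →₀ ℤ) (q : α) : polarPart D q = (-D q).toNat := by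
  simp [polarPart]

/-- An effective divisor, as a divisor. -/
noncomputable def toDivisor {α : Type*} : (α →₀ ℕ) →+ (α →₀ ℤ) :=
  Finsupp.mapRange.addMonoidHom (Nat.castAddMonoidHom ℤ)

theorem toDivisor_apply {α : Type*} (N : α →₀ ℕ) (q : α) : toDivisor N q = N q := by
  simp [toDivisor]

theorem toDivisor_single {L : PeriodPair} (q : Torus L) :
    toDivisor (Finsupp.single q 1) = pt q := by
  simp [toDivisor, pt]

theorem degree_toDivisor {α : Type*} (N : α →₀ ℕ) : (toDivisor N).degree = N.degree := by
  induction N using Finsupp.induction_linear with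
  | zero => simp
  | add f g hf hg => simp [hf, hg]
  | single a n => simp [toDivisor]

theorem eq_toDivisor_sub {α : Type*} (D : α →₀ ℤ) :
    D = toDivisor (polarPart (-D)) - toDivisor (polarPart D) := by
  ext q
  simp only [Finsupp.sub_apply, toDivisor_apply, polarPart_apply, Finsupp.neg_apply]
  omega

theorem degree_polarPart_neg {α : Type*} {D : α →₀ ℤ} (hD : D.degree = 0) :
    (polarPart (-D)).degree = (polarPart D).degree := by
  have h := congrArg Finsupp.degree (eq_toDivisor_sub D)
  rw [map_sub, degree_toDivisor, degree_toDivisor, hD] at h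
  omega

/-- An elliptic function with a nonzero divisor has at least two poles, counted with multiplicity. -/
theorem two_le_degree_polarPart {L : PeriodPair} {f : Torus L → ℂ} {D : Torus L →₀ ℤ}
    (hf : IsMeromorphic f) (hD : HasDivisor f D) (h0 : D ≠ 0) : 2 ≤ (polarPart D).degree := by
  classical
  have hdeg : D.degree = 0 := hD.degree_eq_zero hf
  by_contra hlt
  have hcases : (polarPart D).degree = 0 ∨ (polarPart D).degree = 1 := by omega
  rcases hcases with h | h
  · have h1 := degree_polarPart_neg hdeg
    rw [h] at h1
    rw [Finsupp.degree_eq_zero_iff] at h h1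
    apply h0
    rw [eq_toDivisor_sub D, h, h1]
    simp
  · obtain ⟨q, hq⟩ := exists_eq_single h
    obtain ⟨p, rfl⟩ := proj_surjective L q
    refine not_single_simple_pole (f := lift f) (isPeriodic_comp_proj f) hf (p := p) ?_ ?_
    · rw [hD p]
      have := DFunLike.congr_fun hq (proj L p)
      rw [polarPart_apply] at this
      simp at this
      norm_cast
      omega
    · intro z hz
      rw [hD z]
      have := DFunLike.congr_fun hq (proj L z)
      rw [polarPart_apply, Finsupp.single_apply, if_neg (Ne.symm hz)] at this
      norm_cast
      omega

/-! ### The Weierstrass data on the torus -/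

/-- `φ` does not vanish identically: otherwise `φ = ψ̄` at a zero of `ψ`, which exists because
`ψ` has a pole. -/
theorem IsWeierstrassData.order_φ_ne_top {L : PeriodPair} {P : Torus L} {X : Torus L → Fin 4 → ℝ}
    {φ ψ h : Torus L → ℂ} (hX : IsWeierstrassData P X φ ψ h) {Dψ : Torus L →₀ ℤ}
    (hψ : HasDivisor ψ Dψ) (hψP : Dψ P < 0) (z : ℂ) : meromorphicOrderAt (lift φ) z ≠ ⊤ := by
  intro htop
  have hall : ∀ w, meromorphicOrderAt (lift φ) w = ⊤ := fun w => by
    by_contra hw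
    exact meromorphicOrderAt_ne_top_of_ne_top hX.meromorphic_φ hw z htop
  obtain ⟨q, -, hq⟩ := Finset.exists_pos_of_sum_zero_of_exists_nonzero Dψ
    (hψ.degree_eq_zero hX.meromorphic_ψ) ⟨P, by simpa using hψP.ne, hψP.ne⟩
  obtain ⟨w, rfl⟩ := proj_surjective L q
  have hw : w ∈ punctured P := by
    rintro rfl
    exact lt_asymm hq hψP
  refine hX.ne_conj w hw ?_
  rw [sphereValue_of_pos (by rw [hall w]; exact WithTop.coe_lt_top _),
    sphereValue_of_pos (f := lift ψ) (by rw [hψ w]; exact_mod_cast hq)]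
  simp [sphereConj, OnePoint.map_some]

theorem IsWeierstrassData.order_h_ne_top {L : PeriodPair} {P : Torus L} {X : Torus L → Fin 4 → ℝ}
    {φ ψ h : Torus L → ℂ} (hX : IsWeierstrassData P X φ ψ h) (z : ℂ) :
    meromorphicOrderAt (lift h) z ≠ ⊤ := by
  obtain ⟨w, hw⟩ := (eventually_proj_ne P z).exists
  refine meromorphicOrderAt_ne_top_of_ne_top hX.meromorphic_h (z := w) ?_ z
  rw [hX.zeros_dh w hw]
  exact WithTop.coe_ne_top

/-- The divisor of `dh` consists of the polar divisors of `φ` and `ψ`, and of the end. -/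
theorem IsWeierstrassData.divisor_h {L : PeriodPair} {P : Torus L} {X : Torus L → Fin 4 → ℝ}
    {φ ψ h : Torus L → ℂ} (hX : IsWeierstrassData P X φ ψ h) {Dφ Dψ Dh : Torus L →₀ ℤ}
    (hφ : HasDivisor φ Dφ) (hψ : HasDivisor ψ Dψ) (hh : HasDivisor h Dh)
    (hφP : 0 < Dφ P) (hψP : Dψ P < 0) :
    Dh = Finsupp.single P (Dh P + Dψ P) + toDivisor (polarPart Dφ) + toDivisor (polarPart Dψ) := by
  classical
  ext q
  obtain ⟨z, rfl⟩ := proj_surjective L q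
  simp only [Finsupp.add_apply, toDivisor_apply, polarPart_apply]
  by_cases hz : proj L z = P
  · subst hz
    rw [Finsupp.single_eq_same]
    omega
  · have h1 := hX.zeros_dh z hz
    rw [hh z, poleOrder_eq hφ, poleOrder_eq hψ] at h1
    rw [Finsupp.single_apply, if_neg (Ne.symm hz), zero_add]
    have h2 : Dh (proj L z) = (((-Dφ (proj L z)).toNat + (-Dψ (proj L z)).toNat : ℕ) : ℤ) := by
      exact_mod_cast h1
    rw [h2]
    push_cast
    rfl

/-- The form `φ dh` has no pole except the end, where its pole is not simple. -/
theorem IsWeierstrassData.order_add_order_ne {L : PeriodPair} {P : Torus L}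
    {X : Torus L → Fin 4 → ℝ}
    {φ ψ h : Torus L → ℂ} (hX : IsWeierstrassData P X φ ψ h) {Dφ Dh : Torus L →₀ ℤ}
    (hφ : HasDivisor φ Dφ) (hh : HasDivisor h Dh) : Dφ P + Dh P ≠ -1 := by
  intro hP
  obtain ⟨p, rfl⟩ := proj_surjective L P
  have hmul : ∀ z, meromorphicOrderAt (lift φ * lift h) z =
      ((Dφ (proj L z) + Dh (proj L z) : ℤ) : WithTop ℤ) := fun z => by
    rw [meromorphicOrderAt_mul (hX.meromorphic_φ z) (hX.meromorphic_h z), hφ z, hh z]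
    norm_cast
  refine not_single_simple_pole (f := lift φ * lift h) (p := p)
    (isPeriodic_comp_proj fun q => φ q * h q)
    (fun z => (hX.meromorphic_φ z).mul (hX.meromorphic_h z)) (by rw [hmul p, hP]) fun z hz => ?_
  rw [hmul z]
  have h1 := hX.zeros_dh z hz
  rw [hh z, poleOrder_eq hφ] at h1
  have h2 : Dh (proj L z) = (((-Dφ (proj L z)).toNat + poleOrder (lift ψ) z : ℕ) : ℤ) := by
    exact_mod_cast h1
  have h3 : 0 ≤ Dφ (proj L z) + Dh (proj L z) := by omega
  exact_mod_cast h3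

end StationaryTorus

theorem proposition5p1 (L : PeriodPair) (P : StationaryTorus.Torus L)
    (X : StationaryTorus.Torus L → Fin 4 → ℝ) (φ ψ h : StationaryTorus.Torus L → ℂ)
    (hX : StationaryTorus.IsCompleteAlgebraicStationary P X φ ψ h)
    (hcurv : StationaryTorus.HasTotalCurvature X (8 * Real.pi))
    (hφP : ∀ z : ℂ, StationaryTorus.proj L z = P →
      StationaryTorus.sphereValue (StationaryTorus.lift φ) z = ((0 : ℂ) : OnePoint ℂ))
    (hψP : ∀ z : ℂ, StationaryTorus.proj L z = P →
      StationaryTorus.sphereValue (StationaryTorus.lift ψ) z = OnePoint.infty) :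
    (∃ C₁ C₂ V₁ V₂ N₁ N₂ : StationaryTorus.Torus L,
      C₁ ≠ P ∧ C₂ ≠ P ∧ V₁ ≠ P ∧ V₂ ≠ P ∧ N₁ ≠ P ∧ N₂ ≠ P ∧
      StationaryTorus.HasDivisor φ
        (StationaryTorus.pt P + StationaryTorus.pt C₁
          - StationaryTorus.pt V₁ - StationaryTorus.pt V₂) ∧
      StationaryTorus.HasDivisor ψ
        (-StationaryTorus.pt P - StationaryTorus.pt C₂
          + StationaryTorus.pt N₁ + StationaryTorus.pt N₂) ∧
      StationaryTorus.HasDivisor h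
        (-(3 : ℤ) • StationaryTorus.pt P + StationaryTorus.pt V₁ + StationaryTorus.pt V₂
          + StationaryTorus.pt C₂)) ∨
    (∃ C₁ C₂ V₁ V₂ : StationaryTorus.Torus L,
      C₁ ≠ P ∧ C₂ ≠ P ∧ V₁ ≠ P ∧ V₂ ≠ P ∧
      StationaryTorus.HasDivisor φ
        ((2 : ℤ) • StationaryTorus.pt P - StationaryTorus.pt V₁ - StationaryTorus.pt V₂) ∧
      StationaryTorus.HasDivisor ψ
        (-(2 : ℤ) • StationaryTorus.pt P + StationaryTorus.pt C₁ + StationaryTorus.pt C₂) ∧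
      StationaryTorus.HasDivisor h
        (-(2 : ℤ) • StationaryTorus.pt P + StationaryTorus.pt V₁ + StationaryTorus.pt V₂)) := by
  obtain ⟨p, hp⟩ := StationaryTorus.proj_surjective L P
  have hdata := hX.data
  -- the three divisors, and the signs of the orders at the end
  have hφpos := StationaryTorus.order_pos_of_sphereValue_eq_zero (hdata.meromorphic_φ p) (hφP p hp)
  have hψneg := StationaryTorus.order_neg_of_sphereValue_eq_infty (hψP p hp)
  obtain ⟨Dψ, hψ⟩ := StationaryTorus.exists_hasDivisor hdata.meromorphic_ψ
    (StationaryTorus.meromorphicOrderAt_ne_top_of_ne_top hdata.meromorphic_ψ hψneg.ne_top)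
  rw [hψ p, hp] at hψneg
  have hb : Dψ P < 0 := by exact_mod_cast hψneg
  obtain ⟨Dφ, hφ⟩ := StationaryTorus.exists_hasDivisor hdata.meromorphic_φ
    (hdata.order_φ_ne_top hψ hb)
  rw [hφ p, hp] at hφpos
  have ha : 0 < Dφ P := by exact_mod_cast hφpos
  obtain ⟨Dh, hh⟩ := StationaryTorus.exists_hasDivisor hdata.meromorphic_h hdata.order_h_ne_top
  have hdegφ : Dφ.degree = 0 := hφ.degree_eq_zero hdata.meromorphic_φ
  have hdegψ : Dψ.degree = 0 := hψ.degree_eq_zero hdata.meromorphic_ψ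
  have hdegh : Dh.degree = 0 := hh.degree_eq_zero hdata.meromorphic_h
  have hGB := StationaryTorus.order_add_order_eq_neg_four hX hcurv hφ hψ hh ha hb
  have hDh := hdata.divisor_h hφ hψ hh ha hb
  rw [hGB] at hDh
  -- `deg φ + deg ψ = 4`, and both degrees are at least `2`
  have hsum := congrArg Finsupp.degree hDh
  rw [map_add, map_add, Finsupp.degree_single, StationaryTorus.degree_toDivisor,
    StationaryTorus.degree_toDivisor, hdegh] at hsum
  have hφ2 := StationaryTorus.two_le_degree_polarPart hdata.meromorphic_φ hφ
    (fun h0 => by simp [h0] at ha)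
  have hψ2 := StationaryTorus.two_le_degree_polarPart hdata.meromorphic_ψ hψ
    (fun h0 => by simp [h0] at hb)
  have hφpol : (StationaryTorus.polarPart Dφ).degree = 2 := by omega
  have hψpol : (StationaryTorus.polarPart Dψ).degree = 2 := by omega
  have hφzero := (StationaryTorus.degree_polarPart_neg hdegφ).trans hφpol
  have hψzero := (StationaryTorus.degree_polarPart_neg hdegψ).trans hψpol
  have hres := hdata.order_add_order_ne hφ hh
  have hale : Dφ P ≤ 2 := by
    have := Finsupp.le_degree P (StationaryTorus.polarPart (-Dφ))
    rw [StationaryTorus.polarPart_apply, Finsupp.neg_apply, hφzero] at this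
    omega
  have hble : -2 ≤ Dψ P := by
    have := Finsupp.le_degree P (StationaryTorus.polarPart Dψ)
    rw [StationaryTorus.polarPart_apply, hψpol] at this
    omega
  obtain ⟨V₁, V₂, hV₁, hV₂, hV⟩ := StationaryTorus.exists_eq_of_apply_eq_zero hφpol (P := P)
    (by rw [StationaryTorus.polarPart_apply]; omega)
  have hφeq := StationaryTorus.eq_toDivisor_sub Dφ
  have hψeq := StationaryTorus.eq_toDivisor_sub Dψ
  have hsingle : ∀ n : ℤ, Finsupp.single P n = n • StationaryTorus.pt P := fun n => by
    simp [StationaryTorus.pt]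
  rw [hsingle] at hDh
  rw [hV, map_add, StationaryTorus.toDivisor_single, StationaryTorus.toDivisor_single]
    at hφeq hDh
  have hcases : Dψ P = -1 ∨ Dψ P = -2 := by omega
  rcases hcases with hψ1 | hψ2'
  · left
    have hφ1 : Dφ P = 1 := by omega
    obtain ⟨C₁, hC₁, hCφ⟩ := StationaryTorus.exists_eq_of_apply_eq_one hφzero (P := P)
      (by rw [StationaryTorus.polarPart_apply, Finsupp.neg_apply]; omega)
    obtain ⟨C₂, hC₂, hCψ⟩ := StationaryTorus.exists_eq_of_apply_eq_one hψpol (P := P)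
      (by rw [StationaryTorus.polarPart_apply]; omega)
    obtain ⟨N₁, N₂, hN₁, hN₂, hN⟩ := StationaryTorus.exists_eq_of_apply_eq_zero hψzero (P := P)
      (by rw [StationaryTorus.polarPart_apply, Finsupp.neg_apply]; omega)
    rw [hCφ, map_add, StationaryTorus.toDivisor_single, StationaryTorus.toDivisor_single] at hφeq
    rw [hCψ, map_add, StationaryTorus.toDivisor_single, StationaryTorus.toDivisor_single] at hDh
    rw [hCψ, hN, map_add, map_add, StationaryTorus.toDivisor_single,
      StationaryTorus.toDivisor_single, StationaryTorus.toDivisor_single,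
      StationaryTorus.toDivisor_single] at hψeq
    refine ⟨C₁, C₂, V₁, V₂, N₁, N₂, hC₁, hC₂, hV₁, hV₂, hN₁, hN₂, ?_, ?_, ?_⟩
    · convert hφ using 1
      rw [hφeq]
      abel
    · convert hψ using 1
      rw [hψeq]
      abel
    · convert hh using 1
      rw [hDh]
      module
  · right
    have hφ2' : Dφ P = 2 := by omega
    have hCφ := StationaryTorus.eq_of_apply_eq_two hφzero (P := P)
      (by rw [StationaryTorus.polarPart_apply, Finsupp.neg_apply]; omega)
    have hCψ := StationaryTorus.eq_of_apply_eq_two hψpol (P := P)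
      (by rw [StationaryTorus.polarPart_apply]; omega)
    obtain ⟨C₁, C₂, hC₁, hC₂, hC⟩ := StationaryTorus.exists_eq_of_apply_eq_zero hψzero (P := P)
      (by rw [StationaryTorus.polarPart_apply, Finsupp.neg_apply]; omega)
    rw [hCφ, map_add, StationaryTorus.toDivisor_single] at hφeq
    rw [hCψ, map_add, StationaryTorus.toDivisor_single] at hDh
    rw [hCψ, hC, map_add, map_add, StationaryTorus.toDivisor_single,
      StationaryTorus.toDivisor_single, StationaryTorus.toDivisor_single] at hψeq
    refine ⟨C₁, C₂, V₁, V₂, hC₁, hC₂, hV₁, hV₂, ?_, ?_, ?_⟩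
    · convert hφ using 1
      rw [hφeq]
      module
    · convert hψ using 1
      rw [hψeq]
      module
    · convert hh using 1
      rw [hDh]
      module
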